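/- **Setting.** Let $T>0$, $k,d\ge 1$, $m\ge 2$ and $\mathcal I=\{1,\dots,m\}$. Let $B=(B_t)_{0\le t\le T}$ be a standard $d$-dimensional Brownian motion on a probability space $(\Omega,\mathcal F,P)$, and let $\mathbf F=(\mathcal F_t)_{t\le T}$ be its natural filtration completed with the $P$-null sets of $\mathcal F$. Let $\mathcal M^{2}$ be the set of real $\mathbf F$-progressively measurable processes $w$ with $E\int_0^T|w_s|^2ds<\infty$, and $\mathcal S^2$ the set of real continuous $\mathbf F$-progressively measurable processes $w$ with $E[\sup_{t\le T}|w_t|^2]<\infty$. For $i,j\in\mathcal I$ let $\psi_i,g_{ij}:[0,T]\times\mathbb R^k\to\mathbb R$ be continuous, with $|\psi_i(t,x)|+|g_{ij}(t,x)|\le C(1+|x|^\gamma)$ for some constants $C,\gamma>0$, such that for all $(t,x)$: $g_{ii}=0$, $g_{ij}\ge 0$, $g_{ij}+g_{jl}>g_{il}$ whenever $j\ne i$ and $l\ne j$, and, for some constant $\alpha>0$, $g_{ij}+g_{ji}>\alpha$ whenever $i\neq j$. Let $X=(X_t)_{t\le T}$ be a continuous $\mathbf F$-progressively measurable $\mathbb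 R^k$-valued process such that $(\psi_i(t,X_t))_t\in\mathcal M^{2}$ and $(g_{ij}(t,X_t))_t\in\mathcal S^2$ for all $i,j$. Fix an initial mode $i_0\in\mathcal I$ (for instance $i_0=1$). A strategy $(\delta,\xi)\in\mathcal D$ consists of a nondecreasing sequence $\delta=(\tau_n)_{n\ge1}$ of $[0,T]$-valued $\mathbf F$-stopping times and a sequence $\xi=(\xi_n)_{n\ge1}$ of $\mathcal I$-valued random variables, $\xi_n$ being $\mathcal F_{\tau_n}$-measurable; put $\tau_0=0$, $\xi_0=i_0$. The current mode is $u_t=i_0$ on $[0,\tau_1]$ and $u_t=\xi_n$ on $(\tau_n,\tau_{n+1}]$; if $\tau_n<t$ for all $n$, then $u_t$ is the eventual value of the sequence $(\xi_n)$, or $i_0$ if this sequence is not eventually constant. The expected total profit is $$J(\delta,\xi)=E\Big[\int_0^T\psi_{u_s}(s,X_s)\,ds-\sum_{n\ge1}g_{\xi_{n-1}\xi_n}(\tau_n,X_{\tau_n})\mathbf 1_{[\tau_n<T]}\Big]\in[-\infty,\infty).$$ **Theorem (Verification Theorem).** Let $Y^1,\dots,Y^m\in\mathcal S^2$ satisfy,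 for all $i\in\mathcal I$ and $t\le T$, almost surely $$Y^i_t=\operatorname*{ess\,sup}_{\tau\ge t}E\Big[\int_t^\tau\psi_i(s,X_s)\,ds+\max_{j\ne i}\big(-g_{ij}(\tau,X_\tau)+Y^j_\tau\big)\mathbf 1_{[\tau<T]}\,\Big|\,\mathcal F_t\Big],\qquad Y^i_T=0,$$ where $\tau$ ranges over the $\mathbf F$-stopping times with $t\le\tau\le T$. Then: (i) $Y^{i_0}_0=\sup_{(\delta,\xi)\in\mathcal D}J(\delta,\xi)$ almost surely. (ii) There are strategies $(\delta^*,\xi^*)\in\mathcal D$ such that, for every $n\ge1$ (with $\tau^*_0=0$, $\xi^*_0=i_0$), $$\tau_n^*=\inf\Big\{s\ge\tau^*_{n-1}:\ Y^{\xi^*_{n-1}}_s=\max_{j\ne\xi^*_{n-1}}\big(-g_{\xi^*_{n-1}j}(s,X_s)+Y^j_s\big)\Big\}\wedge T,$$ and $\xi_n^*\neq\xi_{n-1}^*$ is a mode $j$ attaining the maximum $\max_{j\ne\xi^*_{n-1}}\big(-g_{\xi^*_{n-1}j}(\tau_n^*,X_{\tau_n^*})+Y^j_{\tau_n^*}\big)$.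 Every such strategy satisfies $$E\Big[\sum_{n\ge1}g_{\xi^*_{n-1}\xi^*_n}(\tau^*_n,X_{\tau^*_n})\mathbf 1_{[\tau^*_n<T]}\Big]<\infty$$ and is optimal: $J(\delta^*,\xi^*)\ge J(\delta,\xi)$ for all $(\delta,\xi)\in\mathcal D$. (iii) If $(\delta^*,\xi^*)$ is a strategy as in (ii) and either $E\big[\sum_{n\ge1}g_{\xi^*_n\xi^*_{n-1}}(\tau^*_n,X_{\tau^*_n})\mathbf 1_{[\tau^*_n<T]}\big]<\infty$ or all the functions $g_{ij}$ are constant, then this strategy is finite: $P(\tau_n^*<T\text{ for all }n\ge1)=0$. -/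

import Mathlib

open MeasureTheory ProbabilityTheory Filter
open scoped ENNReal

noncomputable section

namespace OptimalSwitching

/-- The time interval `[0, T]`. -/
abbrev TimeSet (T : ℝ) : Type := Set.Icc (0 : ℝ) T

/-- Lebesgue measure on `[0, T]`. -/
instance instMeasureSpaceTimeSet (T : ℝ) : MeasureSpace (TimeSet T) :=
  Measure.Subtype.measureSpace

variable {Ω : Type*} [mΩ : MeasurableSpace Ω] {T : ℝ} {m k d : ℕ}

/-! ### Brownian motion and its completed filtration -/

/-- `B` is a standard `d`-dimensional Brownian motion on `[0, T]`: it starts at `0`, it has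
independent increments, the coordinates of `B_t - B_s` are independent with law `N(0, t - s)`,
and its paths are almost surely continuous. -/
structure IsBrownianMotion (P : Measure Ω) (B : TimeSet T → Ω → (Fin d → ℝ)) : Prop where
  measurable : ∀ t, Measurable (B t)
  zero : ∀ t : TimeSet T, (t : ℝ) = 0 → ∀ᵐ ω ∂P, B t ω = 0
  indep : HasIndepIncrements B P
  law : ∀ s t : TimeSet T, s ≤ t →
    P.map (fun ω => B t ω - B s ω) =
      Measure.pi (fun _ : Fin d => gaussianReal 0 (Real.toNNReal ((t : ℝ) - (s : ℝ))))
  continuous : ∀ᵐ ω ∂P, Continuous fun t => B t ω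

/-- The `σ`-algebra generated by the `P`-null events. -/
@[reducible]
def nullSigma (P : Measure Ω) : MeasurableSpace Ω :=
  MeasurableSpace.generateFrom {A | MeasurableSet A ∧ P A = 0}

theorem nullSigma_le (P : Measure Ω) : nullSigma P ≤ mΩ :=
  MeasurableSpace.generateFrom_le fun _ hA => hA.1

/-- The natural filtration of `B`, completed with the `P`-null events. -/
def completedFiltration (P : Measure Ω) (B : TimeSet T → Ω → (Fin d → ℝ))
    (hB : ∀ t, Measurable (B t)) : Filtration (TimeSet T) mΩ :=
  Filtration.natural B (fun t => (hB t).stronglyMeasurable) ⊔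
    Filtration.const (TimeSet T) (nullSigma P) (nullSigma_le P)

/-- A random time with values in `[0, T]` that is a stopping time of the filtration `F`. -/
def IsStop (F : Filtration (TimeSet T) mΩ) (τ : Ω → TimeSet T) : Prop :=
  IsStoppingTime F fun ω => (τ ω : WithTop (TimeSet T))

/-! ### Spaces of processes -/

/-- The space `𝒮²`: progressively measurable continuous real processes whose supremum over
`[0, T]` is square integrable. -/
structure IsS2 (P : Measure Ω) (F : Filtration (TimeSet T) mΩ) (w : TimeSet T → Ω → ℝ) :
    Prop where
  progressive : IsProgressive F w
  continuous : ∀ ω, Continuous fun t => w t ω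
  sq_sup : ∫⁻ ω, ⨆ t, ‖w t ω‖ₑ ^ 2 ∂P < ∞

/-- The space `ℳ²` of real processes: progressively measurable and square integrable on
`[0, T] × Ω`. -/
structure IsM2 (P : Measure Ω) (F : Filtration (TimeSet T) mΩ) (w : TimeSet T → Ω → ℝ) :
    Prop where
  progressive : IsProgressive F w
  sq_int : ∫⁻ ω, (∫⁻ t, ‖w t ω‖ₑ ^ 2) ∂P < ∞

/-- `Z` is the essential supremum of the family `𝒢` of random variables: the smallest random
variable, up to almost sure equality, that dominates every member of `𝒢` almost surely. -/
structure IsEssSup (P : Measure Ω) (𝒢 : Set (Ω → ℝ)) (Z : Ω → ℝ) : Prop where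
  measurable : Measurable Z
  upper : ∀ f ∈ 𝒢, f ≤ᵐ[P] Z
  least : ∀ Z' : Ω → ℝ, Measurable Z' → (∀ f ∈ 𝒢, f ≤ᵐ[P] Z') → Z ≤ᵐ[P] Z'

/-! ### The data of the switching problem -/

/-- The standing assumptions on the profit rates `ψ i` and the switching costs `g i j`. -/
structure CoefficientAssumptions
    (ψ : Fin m → TimeSet T → EuclideanSpace ℝ (Fin k) → ℝ)
    (g : Fin m → Fin m → TimeSet T → EuclideanSpace ℝ (Fin k) → ℝ) : Prop where
  continuous_profit : ∀ i, Continuous fun p : TimeSet T × EuclideanSpace ℝ (Fin k) => ψ i p.1 p.2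
  continuous_cost : ∀ i j,
    Continuous fun p : TimeSet T × EuclideanSpace ℝ (Fin k) => g i j p.1 p.2
  growth : ∃ C γ : ℝ, 0 < C ∧ 0 < γ ∧ ∀ i j t x, |ψ i t x| + |g i j t x| ≤ C * (1 + ‖x‖ ^ γ)
  cost_self : ∀ i t x, g i i t x = 0
  cost_nonneg : ∀ i j t x, 0 ≤ g i j t x
  cost_triangle : ∀ i j l t x, j ≠ i → l ≠ j → g i l t x < g i j t x + g j l t x
  cost_loop : ∃ α : ℝ, 0 < α ∧ ∀ i j t x, i ≠ j → α < g i j t x + g j i t x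

/-- The obstacle `max_{j ≠ i} (-g_{ij}(t, X_t) + Y^j_t)` seen from mode `i`. It is used for at
least two modes, so that this is a maximum over a nonempty finite set. -/
def obstacle (g : Fin m → Fin m → TimeSet T → EuclideanSpace ℝ (Fin k) → ℝ)
    (X : TimeSet T → Ω → EuclideanSpace ℝ (Fin k)) (Y : Fin m → TimeSet T → Ω → ℝ)
    (i : Fin m) (t : TimeSet T) (ω : Ω) : ℝ :=
  ⨆ j : {j : Fin m // j ≠ i}, (-g i j t (X t ω) + Y j t ω)

/-- The coupled system of Snell envelopes: for every mode `i` and every `t ≤ T`,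
`Y^i_t = esssup_{τ ≥ t} E[∫_t^τ ψ_i(s, X_s) ds + max_{j ≠ i}(-g_{ij}(τ, X_τ) + Y^j_τ) 1_{τ < T} | F_t]`
and `Y^i_T = 0`. -/
def IsSnellSystem (P : Measure Ω) (F : Filtration (TimeSet T) mΩ)
    (ψ : Fin m → TimeSet T → EuclideanSpace ℝ (Fin k) → ℝ)
    (g : Fin m → Fin m → TimeSet T → EuclideanSpace ℝ (Fin k) → ℝ)
    (X : TimeSet T → Ω → EuclideanSpace ℝ (Fin k)) (Y : Fin m → TimeSet T → Ω → ℝ) : Prop :=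
  ∀ i,
    (∀ t : TimeSet T, IsEssSup P
      {f | ∃ τ : Ω → TimeSet T, IsStop F τ ∧ (∀ ω, t ≤ τ ω) ∧
        f = P[fun ω => (∫ s in Set.Ioc t (τ ω), ψ i s (X s ω)) +
          (if (τ ω : ℝ) < T then obstacle g X Y i (τ ω) ω else 0) | F t]}
      (Y i t)) ∧
    (∀ t : TimeSet T, (t : ℝ) = T → ∀ᵐ ω ∂P, Y i t ω = 0)

/-! ### Strategies -/

/-- An admissible strategy started in mode `i₀`: a nondecreasing sequence of stopping times
`τ₁ ≤ τ₂ ≤ …` with values in `[0, T]`, and modes `ξ₁, ξ₂, …` such that `ξ_n` is measurable with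
respect to `F_{τ_n}`. The entries of index `0` are fixed to `τ₀ = 0` and `ξ₀ = i₀`. -/
structure Strategy (F : Filtration (TimeSet T) mΩ) (i₀ : Fin m) where
  time : ℕ → Ω → TimeSet T
  mode : ℕ → Ω → Fin m
  time_zero : ∀ ω, (time 0 ω : ℝ) = 0
  mode_zero : ∀ ω, mode 0 ω = i₀
  time_le_succ : ∀ n ω, time n ω ≤ time (n + 1) ω
  isStop : ∀ n, IsStop F (time n)
  mode_measurable : ∀ n, Measurable[IsStoppingTime.measurableSpace (isStop n)] (mode n)

namespace Strategy

variable {F : Filtration (TimeSet T) mΩ} {i₀ : Fin m}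

open Classical in
/-- The mode `u_t`, equal to `i₀` on `[0, τ₁]` and to `ξ_n` on `(τ_n, τ_{n+1}]`. If all the `τ_n`
are smaller than `t`, then `u_t` is the mode at which the sequence `ξ_n` becomes stationary; if
there is none (infinitely many changes of mode before `t`), then `u_t` is set to `i₀`. -/
def currentMode (S : Strategy F i₀) (t : TimeSet T) (ω : Ω) : Fin m :=
  if h : ∃ n, t ≤ S.time (n + 1) ω then S.mode (Nat.find h) ω
  else if h : ∃ i, ∀ᶠ n in atTop, S.mode n ω = i then h.choose
  else i₀

/-- The expected total switching cost `E[∑_{n ≥ 1} g_{ξ_{n-1} ξ_n}(τ_n, X_{τ_n}) 1_{τ_n < T}]`, as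
an element of `[0, ∞]`. -/
def expectedCost (S : Strategy F i₀) (P : Measure Ω)
    (g : Fin m → Fin m → TimeSet T → EuclideanSpace ℝ (Fin k) → ℝ)
    (X : TimeSet T → Ω → EuclideanSpace ℝ (Fin k)) : ℝ≥0∞ :=
  ∫⁻ ω, ∑' n : ℕ, (if (S.time (n + 1) ω : ℝ) < T then
    ENNReal.ofReal (g (S.mode n ω) (S.mode (n + 1) ω) (S.time (n + 1) ω)
      (X (S.time (n + 1) ω) ω)) else 0) ∂P

/-- The expected total reversed cost `E[∑_{n ≥ 1} g_{ξ_n ξ_{n-1}}(τ_n, X_{τ_n}) 1_{τ_n < T}]`, as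
an element of `[0, ∞]`. -/
def expectedReversedCost (S : Strategy F i₀) (P : Measure Ω)
    (g : Fin m → Fin m → TimeSet T → EuclideanSpace ℝ (Fin k) → ℝ)
    (X : TimeSet T → Ω → EuclideanSpace ℝ (Fin k)) : ℝ≥0∞ :=
  ∫⁻ ω, ∑' n : ℕ, (if (S.time (n + 1) ω : ℝ) < T then
    ENNReal.ofReal (g (S.mode (n + 1) ω) (S.mode n ω) (S.time (n + 1) ω)
      (X (S.time (n + 1) ω) ω)) else 0) ∂P

/-- The expected total profit `J`. The running profit is integrable, whereas the expected cost
may be infinite, in which case `J = -∞`. -/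
def profit (S : Strategy F i₀) (P : Measure Ω)
    (ψ : Fin m → TimeSet T → EuclideanSpace ℝ (Fin k) → ℝ)
    (g : Fin m → Fin m → TimeSet T → EuclideanSpace ℝ (Fin k) → ℝ)
    (X : TimeSet T → Ω → EuclideanSpace ℝ (Fin k)) : EReal :=
  ((∫ ω, (∫ s, ψ (S.currentMode s ω) s (X s ω)) ∂P : ℝ) : EReal) -
    ((S.expectedCost P g X : ℝ≥0∞) : EReal)

/-- The strategy of successive first hitting times of the obstacles: `τ_{n+1}` is the minimum of
`T` and the first time `s ≥ τ_n` at which `Y^{ξ_n}` meets the obstacle seen from `ξ_n` (as an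
infimum in `[0, T]`, where the empty set has infimum `T`), and `ξ_{n+1} ≠ ξ_n` is a mode that
attains the maximum in this obstacle at time `τ_{n+1}`. -/
structure IsFirstHitting (S : Strategy F i₀)
    (g : Fin m → Fin m → TimeSet T → EuclideanSpace ℝ (Fin k) → ℝ)
    (X : TimeSet T → Ω → EuclideanSpace ℝ (Fin k)) (Y : Fin m → TimeSet T → Ω → ℝ) : Prop where
  time_isGLB : ∀ n ω,
    IsGLB {s : TimeSet T | S.time n ω ≤ s ∧
      Y (S.mode n ω) s ω = obstacle g X Y (S.mode n ω) s ω} (S.time (n + 1) ω)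
  mode_ne : ∀ n ω, S.mode (n + 1) ω ≠ S.mode n ω
  mode_argmax : ∀ n ω,
    -g (S.mode n ω) (S.mode (n + 1) ω) (S.time (n + 1) ω) (X (S.time (n + 1) ω) ω) +
        Y (S.mode (n + 1) ω) (S.time (n + 1) ω) ω =
      obstacle g X Y (S.mode n ω) (S.time (n + 1) ω) ω

/-- Almost surely, only finitely many switching times are smaller than `T`. -/
def IsFinite (S : Strategy F i₀) (P : Measure Ω) : Prop :=
  ∀ᵐ ω ∂P, ∃ n, (S.time n ω : ℝ) = T

end Strategy

end OptimalSwitching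

end

open OptimalSwitching

/-!
The proof has three layers.

*A single mode.* Write `R_τ` for the reward of stopping at `τ` and `U = Y + Ψ` for the value plus
the running reward. The essential supremum enters only through expectations: `U_t` dominates
`R_τ` in the mean on every event of the past, and, because the family of conditional rewards is
directed (`IsEssSup.exists_integral_le_add`), some `τ ≥ t` has mean reward close to the mean of
`U_t`. This is the structure `IsEnvelope`. Both facts extend from deterministic times to stopping
times by approximation from above with finitely many values, and together they give optional
sampling (`IsEnvelope.integral_total_le`). If `Y` does not meet the obstacle on `[σ, D)`, then `U`
keeps its mean between `σ` and `D` (`IsEnvelope.integral_total_eq`): nearly optimal stopping times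
after `σ` have small regret `Y - h`, so that by continuity they cannot accumulate before `D`.
The running reward is taken to be `Ψ_t = -∫_t^T ψ_i(s, X_s) ds`. It is not adapted, but it differs
from `∫_0^t ψ_i(s, X_s) ds` by a random variable that is the same for all `t`, and only means of
differences matter.

*Along a strategy.* The quantity `Strategy.meanValue` adds up the mean profit of the strategy
stopped after `n` switches, the mean cost of these switches (negatively) and the mean of `U` in the
current mode at the last switch. It starts at the mean of `Y^{i₀}_0`, it is nonincreasing in `n`
for every strategy, since the value dominates the obstacle, and it is constant for a first hitting
strategy.

*The limit.* If the expected cost is finite, then almost surely the horizon is reached after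
finitely many switches or the modes become stationary (`exists_eventually_eq_of_tendsto_cost`): the
switching times accumulate at a point where otherwise some loop of modes would be free. Hence the
truncated profits converge to the profit. For a first hitting strategy the constancy of the mean
value bounds the expected cost, and successive modes differ, so that the strategy is finite and
earns the mean of `Y^{i₀}_0`. As the initial σ-algebra is trivial, `Y^{i₀}_0` is almost surely
equal to its mean.
-/

open scoped Topology

namespace OptimalSwitching

variable {Ω : Type*} [mΩ : MeasurableSpace Ω] {P : Measure Ω} {T : ℝ}
  {F : Filtration (TimeSet T) mΩ}

/-! ### Stopping times -/

theorem isStop_iff {τ : Ω → TimeSet T} :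
    IsStop F τ ↔ ∀ t, MeasurableSet[F t] {ω | τ ω ≤ t} := by
  simp [IsStop, IsStoppingTime]

theorem IsStop.measurableSet_le {τ : Ω → TimeSet T} (hτ : IsStop F τ) (t : TimeSet T) :
    MeasurableSet[F t] {ω | τ ω ≤ t} :=
  isStop_iff.1 hτ t

theorem isStop_const (t : TimeSet T) : IsStop F fun _ : Ω => t :=
  isStoppingTime_const F t

theorem IsStop.measurable {τ : Ω → TimeSet T} (hτ : IsStop F τ) : Measurable τ :=
  measurable_of_Iic fun t => F.le t _ (hτ.measurableSet_le t)

theorem IsStop.max {σ τ : Ω → TimeSet T} (hσ : IsStop F σ) (hτ : IsStop F τ) :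
    IsStop F fun ω => σ ω ⊔ τ ω := by
  rw [isStop_iff] at *
  intro t
  convert (hσ t).inter (hτ t) using 1
  ext ω
  simp

theorem IsStop.min {σ τ : Ω → TimeSet T} (hσ : IsStop F σ) (hτ : IsStop F τ) :
    IsStop F fun ω => σ ω ⊓ τ ω := by
  rw [isStop_iff] at *
  intro t
  convert (hσ t).union (hτ t) using 1
  ext ω
  simp

theorem IsStop.measurableSet_inter_le {σ : Ω → TimeSet T} (hσ : IsStop F σ) {A : Set Ω}
    (hA : MeasurableSet[IsStoppingTime.measurableSpace hσ] A) (t : TimeSet T) :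
    MeasurableSet[F t] (A ∩ {ω | σ ω ≤ t}) := by
  simpa using hA.2 t

open Classical in
/-- Switching from `σ` to a later stopping time on an event of the past of `σ`. -/
theorem IsStop.piecewise {σ τ : Ω → TimeSet T} (hσ : IsStop F σ) (hτ : IsStop F τ) (hστ : σ ≤ τ)
    {A : Set Ω} (hA : MeasurableSet[IsStoppingTime.measurableSpace hσ] A) :
    IsStop F (A.piecewise τ σ) := by
  rw [isStop_iff]
  intro t
  have h1 := hσ.measurableSet_inter_le hA t
  have h2 := hσ.measurableSet_inter_le hA.compl t
  convert (h1.inter (hτ.measurableSet_le t)).union h2 using 1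
  ext ω
  by_cases h : ω ∈ A
  · simpa [h] using fun h' => (hστ ω).trans h'
  · simp [h]

/-- A stopping time obtained by choosing one of finitely many stopping times, the choice being
made before any of them. -/
theorem isStop_choice {ι : Type*} [Countable ι] {κ : Ω → ι} {p : ι → TimeSet T}
    (hκ : ∀ i, MeasurableSet[F (p i)] {ω | κ ω = i}) {τ : ι → Ω → TimeSet T}
    (hτ : ∀ i, IsStop F (τ i)) (hp : ∀ i ω, p i ≤ τ i ω) : IsStop F fun ω => τ (κ ω) ω := by
  rw [isStop_iff]
  intro t
  have : {ω | τ (κ ω) ω ≤ t} = ⋃ i, {ω | κ ω = i} ∩ {ω | τ i ω ≤ t} := by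
    ext ω
    simp
  rw [this]
  refine MeasurableSet.iUnion fun i => ?_
  by_cases h : p i ≤ t
  · exact (F.mono h _ (hκ i)).inter ((hτ i).measurableSet_le t)
  · convert MeasurableSet.empty
    ext ω
    simpa using fun _ => (not_le.1 h).trans_le (hp i ω)

/-- A stopping time is approximated from above, uniformly, by stopping times with finitely many
values. -/
theorem IsStop.exists_grid (hT : 0 < T) {σ : Ω → TimeSet T} (hσ : IsStop F σ) (N : ℕ) :
    ∃ (κ : Ω → Fin (N + 2)) (p : Fin (N + 2) → TimeSet T),
      (∀ i, MeasurableSet[F (p i)] {ω | κ ω = i}) ∧ (∀ ω, σ ω ≤ p (κ ω)) ∧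
        ∀ ω, (p (κ ω) : ℝ) ≤ σ ω + T / (N + 1) := by
  have hN : (0 : ℝ) < N + 1 := by positivity
  set c : TimeSet T → ℕ := fun x => ⌈(x : ℝ) * (N + 1) / T⌉₊ with hc
  have hcN : ∀ x, c x < N + 2 := fun x => by
    have : c x ≤ N + 1 := by
      refine Nat.ceil_le.2 ?_
      rw [div_le_iff₀ hT]
      push_cast
      have := x.2.2
      nlinarith
    omega
  let p : Fin (N + 2) → TimeSet T := fun i => ⟨i * T / (N + 1), by positivity, by
    rw [div_le_iff₀ hN]
    have : ((i : ℕ) : ℝ) ≤ N + 1 := by exact_mod_cast Nat.lt_succ_iff.1 i.2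
    nlinarith⟩
  have hcp : ∀ x (i : Fin (N + 2)), c x ≤ i ↔ x ≤ p i := fun x i => by
    rw [hc, Nat.ceil_le, ← Subtype.coe_le_coe, div_le_iff₀ hT, le_div_iff₀ hN]
  refine ⟨fun ω => ⟨c (σ ω), hcN _⟩, p, fun i => ?_, fun ω => (hcp _ _).1 le_rfl, fun ω => ?_⟩
  · have hle : ∀ j : Fin (N + 2), j ≤ i → MeasurableSet[F (p i)] {ω | c (σ ω) ≤ j} :=
      fun j hj => by
        have hpj : p j ≤ p i := by
          have : ((j : ℕ) : ℝ) ≤ (i : ℕ) := by exact_mod_cast hj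
          refine Subtype.coe_le_coe.1 ?_
          change (j : ℕ) * T / (N + 1) ≤ (i : ℕ) * T / (N + 1)
          gcongr
        convert F.mono hpj _ (hσ.measurableSet_le (p j)) using 1
        ext ω
        exact hcp _ _
    rcases Nat.eq_zero_or_pos (i : ℕ) with h0 | h0
    · convert hle i le_rfl using 1
      ext ω
      simp only [Fin.ext_iff, Set.mem_ofPred_eq]
      omega
    · convert (hle i le_rfl).diff (hle ⟨i - 1, by omega⟩ (Fin.le_def.2 (Nat.sub_le _ _))) using 1
      ext ω
      simp only [Fin.ext_iff, Set.mem_ofPred_eq, Set.mem_sdiff]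
      omega
  · change (c (σ ω) : ℝ) * T / (N + 1) ≤ _
    have : (c (σ ω) : ℝ) < (σ ω : ℝ) * (N + 1) / T + 1 :=
      Nat.ceil_lt_add_one (div_nonneg (mul_nonneg (σ ω).2.1 hN.le) hT.le)
    calc (c (σ ω) : ℝ) * T / (N + 1) ≤ ((σ ω : ℝ) * (N + 1) / T + 1) * T / (N + 1) := by gcongr
      _ = _ := by field_simp

theorem tendsto_of_grid {α : Type*} {p : ℕ → α → TimeSet T} {σ : α → TimeSet T}
    (hp : ∀ n ω, σ ω ≤ p n ω) (hp' : ∀ (n : ℕ) ω, (p n ω : ℝ) ≤ σ ω + T / (n + 1)) (ω : α) :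
    Tendsto (fun n => p n ω) atTop (𝓝 (σ ω)) := by
  rw [tendsto_subtype_rng]
  refine tendsto_of_tendsto_of_tendsto_of_le_of_le tendsto_const_nhds ?_
    (fun n => Subtype.coe_le_coe.2 (hp n ω)) (fun n => hp' n ω)
  have : Tendsto (fun n : ℕ => T / ((n : ℝ) + 1)) atTop (𝓝 0) :=
    tendsto_const_nhds.div_atTop (tendsto_natCast_atTop_atTop.atTop_add tendsto_const_nhds)
  simpa using tendsto_const_nhds.add this

/-! ### Continuous dominated processes -/

/-- A process with continuous paths and measurable marginals whose paths are dominated by an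
integrable random variable. No adaptedness is required. -/
structure IsDominated (P : Measure Ω) (u : TimeSet T → Ω → ℝ) : Prop where
  continuous : ∀ ω, Continuous fun t => u t ω
  measurable : ∀ t, Measurable (u t)
  bound : ∃ W : Ω → ℝ, Integrable W P ∧ ∀ᵐ ω ∂P, ∀ t, |u t ω| ≤ W ω

namespace IsDominated

variable {u v : TimeSet T → Ω → ℝ}

theorem measurable_comp (hu : IsDominated P u) {τ : Ω → TimeSet T} (hτ : Measurable τ) :
    Measurable fun ω => u (τ ω) ω :=
  (measurable_uncurry_of_continuous_of_measurable (u := u) hu.continuous hu.measurable).comp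
    (hτ.prodMk measurable_id)

theorem integrable_comp (hu : IsDominated P u) {τ : Ω → TimeSet T} (hτ : Measurable τ) :
    Integrable (fun ω => u (τ ω) ω) P := by
  obtain ⟨W, hW, hb⟩ := hu.bound
  exact hW.mono' (hu.measurable_comp hτ).aestronglyMeasurable
    (hb.mono fun ω h => h (τ ω))

theorem integrable (hu : IsDominated P u) (t : TimeSet T) : Integrable (u t) P :=
  hu.integrable_comp (τ := fun _ => t) measurable_const

theorem tendsto_integral (hu : IsDominated P u) {τ : ℕ → Ω → TimeSet T} {σ : Ω → TimeSet T}
    (hτ : ∀ n, Measurable (τ n)) (h : ∀ᵐ ω ∂P, Tendsto (fun n => τ n ω) atTop (𝓝 (σ ω))) :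
    Tendsto (fun n => ∫ ω, u (τ n ω) ω ∂P) atTop (𝓝 (∫ ω, u (σ ω) ω ∂P)) := by
  obtain ⟨W, hW, hb⟩ := hu.bound
  refine tendsto_integral_of_dominated_convergence W
    (fun n => (hu.measurable_comp (hτ n)).aestronglyMeasurable) hW
    (fun n => hb.mono fun ω h => h _) ?_
  filter_upwards [h] with ω hω
  exact ((hu.continuous ω).tendsto _).comp hω

theorem add (hu : IsDominated P u) (hv : IsDominated P v) :
    IsDominated P fun t ω => u t ω + v t ω := by
  obtain ⟨W, hW, hb⟩ := hu.bound
  obtain ⟨W', hW', hb'⟩ := hv.bound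
  refine ⟨fun ω => (hu.continuous ω).add (hv.continuous ω),
    fun t => (hu.measurable t).add (hv.measurable t), _, hW.add hW', ?_⟩
  filter_upwards [hb, hb'] with ω h h' t
  exact (abs_add_le _ _).trans (add_le_add (h t) (h' t))

theorem neg (hu : IsDominated P u) : IsDominated P fun t ω => -u t ω := by
  obtain ⟨W, hW, hb⟩ := hu.bound
  exact ⟨fun ω => (hu.continuous ω).neg, fun t => (hu.measurable t).neg, W, hW, by simpa using hb⟩

/-- The maximum of finitely many dominated processes. -/
theorem iSup {ι : Type*} [Finite ι] [Nonempty ι] {w : ι → TimeSet T → Ω → ℝ}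
    (hw : ∀ i, IsDominated P (w i)) : IsDominated P fun t ω => ⨆ i, w i t ω := by
  have := Fintype.ofFinite ι
  choose W hW hb using fun i => (hw i).bound
  refine ⟨fun ω => ?_, fun t => Measurable.iSup fun i => (hw i).measurable t,
    fun ω => ∑ i, W i ω, integrable_finsetSum _ fun i _ => hW i, ?_⟩
  · simp_rw [← Finset.sup'_univ_eq_ciSup]
    exact Continuous.finset_sup'_apply _ fun i _ => (hw i).continuous ω
  · filter_upwards [ae_all_iff.2 hb] with ω h t
    have key : ∀ i, |w i t ω| ≤ ∑ i, W i ω := fun i => (h i t).trans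
      (Finset.single_le_sum (f := fun i => W i ω)
        (fun j _ => (abs_nonneg _).trans (h j t)) (Finset.mem_univ i))
    refine abs_le.2 ⟨?_, ciSup_le fun i => (abs_le.1 (key i)).2⟩
    obtain ⟨i⟩ := ‹Nonempty ι›
    exact (abs_le.1 (key i)).1.trans
      (le_ciSup (f := fun i => w i t ω) (Set.finite_range _).bddAbove i)

end IsDominated

theorem integral_eq_sum_setIntegral {ι : Type*} [Fintype ι] {κ : Ω → ι}
    (hκ : ∀ i, MeasurableSet {ω | κ ω = i}) {f : Ω → ℝ} (hf : Integrable f P) :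
    ∫ ω, f ω ∂P = ∑ i, ∫ ω in {ω | κ ω = i}, f ω ∂P := by
  rw [← integral_iUnion_fintype hκ]
  · have : (⋃ i, {ω | κ ω = i}) = Set.univ := by
      ext ω
      simp
    rw [this, Measure.restrict_univ]
  · intro i j hij
    exact Set.disjoint_left.2 fun ω h h' => hij (h.symm.trans h')
  · exact fun i => hf.integrableOn

end OptimalSwitching

namespace OptimalSwitching

variable {Ω : Type*} [mΩ : MeasurableSpace Ω] {P : Measure Ω} {T : ℝ}
  {F : Filtration (TimeSet T) mΩ}

/-! ### Optimal stopping with a continuous value process -/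

/-- The reward for stopping at time `t`: the running part `Ψ_t`, and the obstacle `h_t` if
`t < T`. -/
noncomputable def stopReward (Ψ h : TimeSet T → Ω → ℝ) (t : TimeSet T) (ω : Ω) : ℝ :=
  Ψ t ω + if (t : ℝ) < T then h t ω else 0

section

variable {Ψ h : TimeSet T → Ω → ℝ} {τ : Ω → TimeSet T}

theorem measurableSet_lt_horizon (hτ : Measurable τ) : MeasurableSet {ω | (τ ω : ℝ) < T} :=
  measurableSet_lt (measurable_subtype_coe.comp hτ) measurable_const

theorem measurable_stopReward (hΨ : IsDominated P Ψ) (hh : IsDominated P h) (hτ : Measurable τ) :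
    Measurable fun ω => stopReward Ψ h (τ ω) ω :=
  (hΨ.measurable_comp hτ).add
    (Measurable.ite (measurableSet_lt_horizon hτ) (hh.measurable_comp hτ) measurable_const)

theorem exists_stopReward_bound (hΨ : IsDominated P Ψ) (hh : IsDominated P h) :
    ∃ W : Ω → ℝ, Integrable W P ∧ ∀ᵐ ω ∂P, ∀ t, |stopReward Ψ h t ω| ≤ W ω := by
  obtain ⟨W, hW, hb⟩ := hΨ.bound
  obtain ⟨W', hW', hb'⟩ := hh.bound
  refine ⟨_, hW.add hW', ?_⟩
  filter_upwards [hb, hb'] with ω h h' t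
  refine (abs_add_le _ _).trans (add_le_add (h t) ?_)
  split_ifs
  · exact h' t
  · simpa using (abs_nonneg _).trans (h' t)

theorem integrable_stopReward (hΨ : IsDominated P Ψ) (hh : IsDominated P h) (hτ : Measurable τ) :
    Integrable (fun ω => stopReward Ψ h (τ ω) ω) P := by
  obtain ⟨W, hW, hb⟩ := exists_stopReward_bound hΨ hh
  exact hW.mono' (measurable_stopReward hΨ hh hτ).aestronglyMeasurable
    (hb.mono fun ω h => h (τ ω))

/-- The stopping reward is right-continuous in the stopping time. -/
theorem tendsto_integral_stopReward (hΨ : IsDominated P Ψ) (hh : IsDominated P h)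
    {τ : ℕ → Ω → TimeSet T} {σ : Ω → TimeSet T} (hτ : ∀ n, Measurable (τ n))
    (hle : ∀ n ω, σ ω ≤ τ n ω) (hlim : ∀ ω, Tendsto (fun n => τ n ω) atTop (𝓝 (σ ω))) :
    Tendsto (fun n => ∫ ω, stopReward Ψ h (τ n ω) ω ∂P) atTop
      (𝓝 (∫ ω, stopReward Ψ h (σ ω) ω ∂P)) := by
  obtain ⟨W, hW, hb⟩ := exists_stopReward_bound hΨ hh
  refine tendsto_integral_of_dominated_convergence W
    (fun n => (measurable_stopReward hΨ hh (hτ n)).aestronglyMeasurable) hW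
    (fun n => hb.mono fun ω h => h _) (ae_of_all _ fun ω => ?_)
  refine (((hΨ.continuous ω).tendsto _).comp (hlim ω)).add ?_
  by_cases hσ : (σ ω : ℝ) < T
  · have hev : ∀ᶠ n in atTop, (τ n ω : ℝ) < T :=
      ((continuous_subtype_val.tendsto _).comp (hlim ω)).eventually (gt_mem_nhds hσ)
    rw [if_pos hσ]
    refine ((((hh.continuous ω).tendsto _).comp (hlim ω))).congr' ?_
    filter_upwards [hev] with n hn
    simp [hn]
  · rw [if_neg hσ]
    refine tendsto_const_nhds.congr fun n => ?_
    rw [if_neg]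
    exact fun h' => hσ ((Subtype.coe_le_coe.2 (hle n ω)).trans_lt h')

end

/-- The analytic content of the statement that `Y_t + Ψ_t` is the value at time `t` of the optimal
stopping problem with reward `stopReward Ψ h`, expressed through expectations at deterministic
times only: on every event of the past no stopping time does better in the mean, and some stopping
time is nearly optimal. -/
structure IsEnvelope (P : Measure Ω) (F : Filtration (TimeSet T) mΩ)
    (Y h Ψ : TimeSet T → Ω → ℝ) : Prop where
  value : IsDominated P Y
  obstacle : IsDominated P h
  running : IsDominated P Ψ
  terminal : ∀ᵐ ω ∂P, ∀ t : TimeSet T, (t : ℝ) = T → Y t ω = 0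
  obstacle_le : ∀ᵐ ω ∂P, ∀ t, h t ω ≤ Y t ω
  setIntegral_reward_le : ∀ (t : TimeSet T) (τ : Ω → TimeSet T), IsStop F τ → (∀ ω, t ≤ τ ω) →
    ∀ A, MeasurableSet[F t] A →
      ∫ ω in A, stopReward Ψ h (τ ω) ω ∂P ≤ ∫ ω in A, (Y t ω + Ψ t ω) ∂P
  exists_near_optimal : ∀ (t : TimeSet T) (δ : ℝ), 0 < δ → ∃ τ : Ω → TimeSet T,
    IsStop F τ ∧ (∀ ω, t ≤ τ ω) ∧
      ∫ ω, (Y t ω + Ψ t ω) ∂P ≤ ∫ ω, stopReward Ψ h (τ ω) ω ∂P + δ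

namespace IsEnvelope

variable {Y h Ψ : TimeSet T → Ω → ℝ}

theorem total (hE : IsEnvelope P F Y h Ψ) : IsDominated P fun t ω => Y t ω + Ψ t ω :=
  hE.value.add hE.running

/-- The mean reward of a stopping time is at most the mean value at an earlier stopping time with
finitely many values. -/
theorem integral_reward_le_of_finite (hE : IsEnvelope P F Y h Ψ) {ι : Type*} [Fintype ι]
    {κ : Ω → ι} {p : ι → TimeSet T} (hκ : ∀ i, MeasurableSet[F (p i)] {ω | κ ω = i})
    {τ : Ω → TimeSet T} (hτ : IsStop F τ) (hp : ∀ ω, p (κ ω) ≤ τ ω) :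
    ∫ ω, stopReward Ψ h (τ ω) ω ∂P ≤ ∫ ω, (Y (p (κ ω)) ω + Ψ (p (κ ω)) ω) ∂P := by
  have hκ' : ∀ i, MeasurableSet {ω | κ ω = i} := fun i => F.le _ _ (hκ i)
  have hpκ : IsStop F fun ω => p (κ ω) :=
    isStop_choice hκ (fun i => isStop_const (p i)) fun _ _ => le_rfl
  rw [integral_eq_sum_setIntegral hκ' (integrable_stopReward hE.running hE.obstacle hτ.measurable),
    integral_eq_sum_setIntegral hκ' (hE.total.integrable_comp hpκ.measurable)]
  refine Finset.sum_le_sum fun i _ => ?_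
  have h1 := hE.setIntegral_reward_le (p i) _ (hτ.max (isStop_const (p i)))
    (fun ω => le_sup_right) _ (hκ i)
  have e1 : ∫ ω in {ω | κ ω = i}, stopReward Ψ h (τ ω) ω ∂P =
      ∫ ω in {ω | κ ω = i}, stopReward Ψ h (τ ω ⊔ p i) ω ∂P :=
    setIntegral_congr_fun (hκ' i) fun ω hω => by
      have hω : κ ω = i := hω
      have : τ ω ⊔ p i = τ ω := sup_eq_left.2 (hω ▸ hp ω)
      simp only [this]
  have e2 : ∫ ω in {ω | κ ω = i}, (Y (p (κ ω)) ω + Ψ (p (κ ω)) ω) ∂P =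
      ∫ ω in {ω | κ ω = i}, (Y (p i) ω + Ψ (p i) ω) ∂P :=
    setIntegral_congr_fun (hκ' i) fun ω hω => by
      have hω : κ ω = i := hω
      simp only [hω]
  rw [e1, e2]
  exact h1

theorem integral_reward_le (hT : 0 < T) (hE : IsEnvelope P F Y h Ψ) {σ τ : Ω → TimeSet T}
    (hσ : IsStop F σ) (hτ : IsStop F τ) (hστ : ∀ ω, σ ω ≤ τ ω) :
    ∫ ω, stopReward Ψ h (τ ω) ω ∂P ≤ ∫ ω, (Y (σ ω) ω + Ψ (σ ω) ω) ∂P := by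
  choose κ p hκ hle hle' using fun N => hσ.exists_grid hT N
  have hpκ : ∀ n, IsStop F fun ω => p n (κ n ω) := fun n =>
    isStop_choice (hκ n) (fun i => isStop_const (p n i)) fun _ _ => le_rfl
  have hlim := tendsto_of_grid (p := fun n ω => p n (κ n ω)) hle hle'
  refine le_of_tendsto_of_tendsto'
    (tendsto_integral_stopReward hE.running hE.obstacle
      (τ := fun n ω => τ ω ⊔ p n (κ n ω)) (fun n => (hτ.max (hpκ n)).measurable)
      (fun n ω => le_sup_left) fun ω => ?_)
    (hE.total.tendsto_integral (fun n => (hpκ n).measurable) (ae_of_all _ hlim))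
    fun n => hE.integral_reward_le_of_finite (hκ n) (hτ.max (hpκ n)) fun ω => le_sup_right
  have := (tendsto_const_nhds (x := τ ω)).sup_nhds (hlim ω)
  rwa [sup_eq_left.2 (hστ ω)] at this

/-- Nearly optimal stopping times exist also after a stopping time. -/
theorem exists_near_optimal_after (hT : 0 < T) (hE : IsEnvelope P F Y h Ψ) {σ : Ω → TimeSet T}
    (hσ : IsStop F σ) {δ : ℝ} (hδ : 0 < δ) :
    ∃ τ : Ω → TimeSet T, IsStop F τ ∧ (∀ ω, σ ω ≤ τ ω) ∧
      ∫ ω, (Y (σ ω) ω + Ψ (σ ω) ω) ∂P ≤ ∫ ω, stopReward Ψ h (τ ω) ω ∂P + δ := by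
  choose κ p hκ hle hle' using fun N => hσ.exists_grid hT N
  have hpκ : ∀ n, IsStop F fun ω => p n (κ n ω) := fun n =>
    isStop_choice (hκ n) (fun i => isStop_const (p n i)) fun _ _ => le_rfl
  have hlim := hE.total.tendsto_integral (fun n => (hpκ n).measurable)
    (ae_of_all _ (tendsto_of_grid (p := fun n ω => p n (κ n ω)) hle hle'))
  obtain ⟨n, hn⟩ := (hlim.eventually (lt_mem_nhds (sub_lt_self _ (half_pos hδ)))).exists
  set ε : ℝ := δ / 2 / (n + 2) with hε
  have hε0 : 0 < ε := by positivity
  choose τ hτ hpτ hopt using fun i => hE.exists_near_optimal (p n i) ε hε0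
  have hτκ := isStop_choice (hκ n) hτ hpτ
  refine ⟨fun ω => τ (κ n ω) ω, hτκ, fun ω => (hle n ω).trans (hpτ _ ω), ?_⟩
  have hκ' : ∀ i, MeasurableSet {ω | κ n ω = i} := fun i => F.le _ _ (hκ n i)
  have hstep : ∀ i, ∫ ω in {ω | κ n ω = i}, (Y (p n i) ω + Ψ (p n i) ω) ∂P ≤
      ∫ ω in {ω | κ n ω = i}, stopReward Ψ h (τ i ω) ω ∂P + ε := fun i => by
    have h1 := hE.setIntegral_reward_le (p n i) (τ i) (hτ i) (hpτ i) _ (hκ n i).compl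
    have h2 := integral_add_compl (hκ' i) (hE.total.integrable (p n i))
    have h3 := integral_add_compl (hκ' i)
      (integrable_stopReward hE.running hE.obstacle (hτ i).measurable)
    have h4 := hopt i
    linarith
  have hsum : ∫ ω, (Y (p n (κ n ω)) ω + Ψ (p n (κ n ω)) ω) ∂P ≤
      ∫ ω, stopReward Ψ h (τ (κ n ω) ω) ω ∂P + δ / 2 := by
    rw [integral_eq_sum_setIntegral hκ' (hE.total.integrable_comp (hpκ n).measurable),
      integral_eq_sum_setIntegral hκ'
        (integrable_stopReward hE.running hE.obstacle hτκ.measurable)]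
    calc _ = ∑ i, ∫ ω in {ω | κ n ω = i}, (Y (p n i) ω + Ψ (p n i) ω) ∂P := by
          refine Finset.sum_congr rfl fun i _ => setIntegral_congr_fun (hκ' i) fun ω hω => ?_
          have hω : κ n ω = i := hω
          simp only [hω]
      _ ≤ ∑ i, (∫ ω in {ω | κ n ω = i}, stopReward Ψ h (τ i ω) ω ∂P + ε) :=
          Finset.sum_le_sum fun i _ => hstep i
      _ = ∑ i, ∫ ω in {ω | κ n ω = i}, stopReward Ψ h (τ i ω) ω ∂P + δ / 2 := by
          rw [Finset.sum_add_distrib, Finset.sum_const, Finset.card_univ, Fintype.card_fin,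
            nsmul_eq_mul, hε]
          push_cast
          field_simp
      _ = _ := by
          congr 1
          refine Finset.sum_congr rfl fun i _ => setIntegral_congr_fun (hκ' i) fun ω hω => ?_
          have hω : κ n ω = i := hω
          simp only [hω]
  linarith

/-- Optional sampling for the supermartingale `Y + Ψ`. -/
theorem integral_total_le (hT : 0 < T) (hE : IsEnvelope P F Y h Ψ) {σ τ : Ω → TimeSet T}
    (hσ : IsStop F σ) (hτ : IsStop F τ) (hστ : ∀ ω, σ ω ≤ τ ω) :
    ∫ ω, (Y (τ ω) ω + Ψ (τ ω) ω) ∂P ≤ ∫ ω, (Y (σ ω) ω + Ψ (σ ω) ω) ∂P := by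
  refine le_of_forall_pos_le_add fun δ hδ => ?_
  obtain ⟨ρ, hρ, hτρ, hopt⟩ := hE.exists_near_optimal_after hT hτ hδ
  have := hE.integral_reward_le hT hσ hρ fun ω => (hστ ω).trans (hτρ ω)
  linarith

/-- The stopping reward never exceeds the total value. -/
theorem stopReward_le (hE : IsEnvelope P F Y h Ψ) :
    ∀ᵐ ω ∂P, ∀ t, stopReward Ψ h t ω ≤ Y t ω + Ψ t ω := by
  filter_upwards [hE.obstacle_le, hE.terminal] with ω h1 h2 t
  unfold stopReward
  split_ifs with ht
  · linarith [h1 t]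
  · linarith [h2 t (le_antisymm t.2.2 (not_lt.1 ht))]

/-- As long as the value process has not met the obstacle, the supermartingale `Y + Ψ` is a
martingale. -/
theorem integral_total_eq (hT : 0 < T) (hE : IsEnvelope P F Y h Ψ) {σ D : Ω → TimeSet T}
    (hσ : IsStop F σ) (hD : IsStop F D) (hσD : ∀ ω, σ ω ≤ D ω)
    (hcontact : ∀ ω t, σ ω ≤ t → t < D ω → Y t ω ≠ h t ω) :
    ∫ ω, (Y (D ω) ω + Ψ (D ω) ω) ∂P = ∫ ω, (Y (σ ω) ω + Ψ (σ ω) ω) ∂P := by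
  refine le_antisymm (hE.integral_total_le hT hσ hD hσD) ?_
  choose τ hτ hστ hopt using fun n : ℕ =>
    hE.exists_near_optimal_after hT hσ (δ := (1 / 2 : ℝ) ^ n) (by positivity)
  -- The regret of stopping at `τ n` is summable in the mean, so it tends to zero almost surely.
  set e : ℕ → Ω → ℝ := fun n ω => Y (τ n ω) ω + Ψ (τ n ω) ω - stopReward Ψ h (τ n ω) ω with he
  have hei : ∀ n, Integrable (e n) P := fun n =>
    (hE.total.integrable_comp (hτ n).measurable).sub
      (integrable_stopReward hE.running hE.obstacle (hτ n).measurable)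
  have he0 : ∀ n, 0 ≤ᵐ[P] e n := fun n => by
    filter_upwards [hE.stopReward_le] with ω hω
    exact sub_nonneg.2 (hω _)
  have heint : ∀ n, ∫ ω, e n ω ∂P ≤ (1 / 2 : ℝ) ^ n := fun n => by
    rw [integral_sub (hE.total.integrable_comp (hτ n).measurable)
      (integrable_stopReward hE.running hE.obstacle (hτ n).measurable)]
    have := hE.integral_total_le hT hσ (hτ n) (hστ n)
    linarith [hopt n]
  have hsum : ∀ᵐ ω ∂P, Tendsto (fun n => e n ω) atTop (𝓝 0) := by
    have h1 : ∫⁻ ω, ∑' n, ENNReal.ofReal (e n ω) ∂P ≠ ∞ := by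
      rw [lintegral_tsum fun n => (hei n).aestronglyMeasurable.aemeasurable.ennreal_ofReal]
      refine ne_top_of_le_ne_top (b := ∑' n : ℕ, ENNReal.ofReal ((1 / 2 : ℝ) ^ n)) ?_
        (ENNReal.tsum_le_tsum fun n => ?_)
      · exact (summable_geometric_two).tsum_ofReal_ne_top
      · rw [← ofReal_integral_eq_lintegral_ofReal (hei n) (he0 n)]
        exact ENNReal.ofReal_le_ofReal (heint n)
    have h2 := ae_lt_top' (AEMeasurable.tsum
      fun n => (hei n).aestronglyMeasurable.aemeasurable.ennreal_ofReal) h1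
    filter_upwards [h2, ae_all_iff.2 he0] with ω hω hω0
    have h3 := ENNReal.tendsto_atTop_zero_of_tsum_ne_top hω.ne
    have h4 := (ENNReal.tendsto_toReal ENNReal.zero_ne_top).comp h3
    refine h4.congr fun n => ?_
    simp [ENNReal.toReal_ofReal (hω0 n)]
  have hmin : ∀ n, IsStop F fun ω => τ n ω ⊓ D ω := fun n => (hτ n).min hD
  have hlim : ∀ᵐ ω ∂P, Tendsto (fun n => τ n ω ⊓ D ω) atTop (𝓝 (D ω)) := by
    filter_upwards [hsum] with ω hω
    -- A cluster point below `D` would be a point of contact.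
    refine tendsto_of_subseq_tendsto fun ns hns => ?_
    obtain ⟨s, -, φ, hφ, hs⟩ := isCompact_univ.tendsto_subseq
      (x := fun k => τ (ns k) ω ⊓ D ω) fun _ => Set.mem_univ _
    refine ⟨φ, ?_⟩
    suffices s = D ω by rwa [this] at hs
    have hsD : s ≤ D ω := le_of_tendsto' hs fun k => inf_le_right
    have hσs : σ ω ≤ s := ge_of_tendsto' hs fun k => le_inf (hστ _ ω) (hσD ω)
    by_contra hne
    have hlt : s < D ω := lt_of_le_of_ne hsD hne
    refine hcontact ω s hσs hlt ?_
    have hev : ∀ᶠ k in atTop, τ (ns (φ k)) ω < D ω := by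
      filter_upwards [hs.eventually (gt_mem_nhds hlt)] with k hk
      simpa using hk
    have hs' : Tendsto (fun k => τ (ns (φ k)) ω) atTop (𝓝 s) := by
      refine hs.congr' ?_
      filter_upwards [hev] with k hk
      exact inf_eq_left.2 hk.le
    have h1 : Tendsto (fun k => Y (τ (ns (φ k)) ω) ω - h (τ (ns (φ k)) ω) ω) atTop
        (𝓝 (Y s ω - h s ω)) :=
      (((hE.value.continuous ω).sub (hE.obstacle.continuous ω)).tendsto s).comp hs'
    have h2 : Tendsto (fun k => e (ns (φ k)) ω) atTop (𝓝 0) :=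
      hω.comp (hns.comp hφ.tendsto_atTop)
    have h3 : Tendsto (fun k => e (ns (φ k)) ω) atTop (𝓝 (Y s ω - h s ω)) := by
      refine h1.congr' ?_
      filter_upwards [hev] with k hk
      have hkT : (τ (ns (φ k)) ω : ℝ) < T := (Subtype.coe_lt_coe.2 hk).trans_le (D ω).2.2
      simp only [he, stopReward, hkT, if_true]
      ring
    exact sub_eq_zero.1 (tendsto_nhds_unique h3 h2)
  have hconv := hE.total.tendsto_integral (fun n => (hmin n).measurable) hlim
  have hpow : Tendsto (fun n : ℕ => (1 / 2 : ℝ) ^ n) atTop (𝓝 0) :=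
    tendsto_pow_atTop_nhds_zero_of_lt_one (by norm_num) (by norm_num)
  have hconv' := hconv.add hpow
  rw [add_zero] at hconv'
  refine ge_of_tendsto' hconv' fun n => (hopt n).trans ?_
  have h1 : ∫ ω, stopReward Ψ h (τ n ω) ω ∂P ≤ ∫ ω, (Y (τ n ω) ω + Ψ (τ n ω) ω) ∂P :=
    integral_mono_ae (integrable_stopReward hE.running hE.obstacle (hτ n).measurable)
      (hE.total.integrable_comp (hτ n).measurable) (hE.stopReward_le.mono fun ω hω => hω _)
  have h2 := hE.integral_total_le hT (hmin n) (hτ n) fun ω => inf_le_left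
  linarith

open Classical in
theorem setIntegral_sub_eq_piecewise {u : TimeSet T → Ω → ℝ} (hu : IsDominated P u)
    {σ τ : Ω → TimeSet T} (hσ : Measurable σ) (hτ : Measurable τ) {A : Set Ω}
    (hA : MeasurableSet A) :
    ∫ ω in A, u (τ ω) ω ∂P - ∫ ω in A, u (σ ω) ω ∂P =
      ∫ ω, u (A.piecewise τ σ ω) ω ∂P - ∫ ω, u (σ ω) ω ∂P := by
  have hm : Measurable (A.piecewise τ σ) := hτ.piecewise hA hσ
  rw [← integral_add_compl hA (hu.integrable_comp hm), ← integral_add_compl hA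
    (hu.integrable_comp hσ)]
  have h1 : ∫ ω in A, u (A.piecewise τ σ ω) ω ∂P = ∫ ω in A, u (τ ω) ω ∂P :=
    setIntegral_congr_fun hA fun ω hω => by simp [Set.piecewise_eq_of_mem _ _ _ hω]
  have h2 : ∫ ω in Aᶜ, u (A.piecewise τ σ ω) ω ∂P = ∫ ω in Aᶜ, u (σ ω) ω ∂P :=
    setIntegral_congr_fun hA.compl fun ω hω => by simp [Set.piecewise_eq_of_notMem _ _ _ hω]
  rw [h1, h2]
  ring

theorem setIntegral_total_le (hT : 0 < T) (hE : IsEnvelope P F Y h Ψ) {σ τ : Ω → TimeSet T}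
    (hσ : IsStop F σ) (hτ : IsStop F τ) (hστ : ∀ ω, σ ω ≤ τ ω) {A : Set Ω}
    (hA : MeasurableSet[IsStoppingTime.measurableSpace hσ] A) :
    ∫ ω in A, (Y (τ ω) ω + Ψ (τ ω) ω) ∂P ≤ ∫ ω in A, (Y (σ ω) ω + Ψ (σ ω) ω) ∂P := by
  classical
  have hA' : MeasurableSet A := IsStoppingTime.measurableSpace_le hσ _ hA
  have h1 := setIntegral_sub_eq_piecewise hE.total hσ.measurable hτ.measurable hA'
  have h2 := hE.integral_total_le hT hσ (hσ.piecewise hτ hστ hA) fun ω => by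
    by_cases hω : ω ∈ A <;> simp [hω, hστ ω]
  linarith

theorem setIntegral_total_eq (hT : 0 < T) (hE : IsEnvelope P F Y h Ψ) {σ D : Ω → TimeSet T}
    (hσ : IsStop F σ) (hD : IsStop F D) (hσD : ∀ ω, σ ω ≤ D ω) {A : Set Ω}
    (hA : MeasurableSet[IsStoppingTime.measurableSpace hσ] A)
    (hcontact : ∀ ω ∈ A, ∀ t, σ ω ≤ t → t < D ω → Y t ω ≠ h t ω) :
    ∫ ω in A, (Y (D ω) ω + Ψ (D ω) ω) ∂P = ∫ ω in A, (Y (σ ω) ω + Ψ (σ ω) ω) ∂P := by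
  classical
  have hA' : MeasurableSet A := IsStoppingTime.measurableSpace_le hσ _ hA
  have h1 := setIntegral_sub_eq_piecewise hE.total hσ.measurable hD.measurable hA'
  have h2 := hE.integral_total_eq hT hσ (hσ.piecewise hD hσD hA)
    (fun ω => by by_cases hω : ω ∈ A <;> simp [hω, hσD ω]) fun ω t h1 h2 => by
      by_cases hω : ω ∈ A
      · exact hcontact ω hω t h1 (by simpa [hω] using h2)
      · exact absurd h1 (not_le.2 (by simpa [hω] using h2))
  linarith

end IsEnvelope

end OptimalSwitching

namespace OptimalSwitching

/-! ### Integrals over the time interval and domination -/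

section

variable {T : ℝ}

instance : IsFiniteMeasure (volume : Measure (TimeSet T)) where
  measure_univ_lt_top := by
    rw [Measure.Subtype.volume_univ measurableSet_Icc.nullMeasurableSet]
    exact measure_Icc_lt_top

instance : NullSingletonClass (volume : Measure (TimeSet T)) where
  measure_singleton x := by
    rw [Measure.Subtype.volume_def, comap_subtype_coe_apply measurableSet_Icc]
    simp

theorem integrable_of_continuous {f : TimeSet T → ℝ} (hf : Continuous f) :
    Integrable f := by
  obtain ⟨C, hC⟩ := isCompact_univ.exists_bound_of_continuousOn hf.continuousOn
  exact Integrable.of_bound hf.measurable.aestronglyMeasurable C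
    (ae_of_all _ fun t => hC t (Set.mem_univ t))

theorem setIntegral_Ioc_eq_sub {f : TimeSet T → ℝ} (hf : Integrable f) {s t : TimeSet T}
    (hst : s ≤ t) : ∫ r in Set.Ioc s t, f r = (∫ r in Set.Ioi s, f r) - ∫ r in Set.Ioi t, f r := by
  rw [← Set.Ioc_union_Ioi_eq_Ioi hst, setIntegral_union Set.Ioc_disjoint_Ioi_same
    measurableSet_Ioi hf.integrableOn hf.integrableOn]
  ring

theorem setIntegral_Ioi_of_eq_zero (f : TimeSet T → ℝ) {t : TimeSet T} (ht : (t : ℝ) = 0) :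
    ∫ r in Set.Ioi t, f r = ∫ r, f r := by
  have : (Set.univ : Set (TimeSet T)) = Set.Ici t := by
    ext r
    simpa [← Subtype.coe_le_coe, ht] using r.2.1
  rw [← integral_Ici_eq_integral_Ioi, ← this, setIntegral_univ]

theorem setIntegral_Ioi_of_eq_horizon (f : TimeSet T → ℝ) {t : TimeSet T} (ht : (t : ℝ) = T) :
    ∫ r in Set.Ioi t, f r = 0 := by
  have : Set.Ioi t = ∅ := by
    ext r
    simpa [← Subtype.coe_le_coe, ht] using r.2.2
  simp [this]

theorem continuous_setIntegral_Ioi {f : TimeSet T → ℝ} (hf : Integrable f) :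
    Continuous fun t => ∫ r in Set.Ioi t, f r := by
  refine continuous_iff_continuousAt.2 fun t => ?_
  simp_rw [← integral_indicator measurableSet_Ioi]
  refine continuousAt_of_dominated (bound := fun r => ‖f r‖)
    (Eventually.of_forall fun s => (hf.indicator measurableSet_Ioi).aestronglyMeasurable)
    (Eventually.of_forall fun s => ae_of_all _ fun r => norm_indicator_le_norm_self _ _) hf.norm ?_
  have hne : ∀ᵐ r : TimeSet T, r ≠ t := by simp [ae_iff]
  filter_upwards [hne] with r hr
  refine ContinuousAt.congr (f := fun _ => (Set.Ioi t).indicator f r) continuousAt_const ?_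
  rcases lt_or_gt_of_ne hr with h | h
  · filter_upwards [lt_mem_nhds h] with s hs
    simp [Set.indicator, hs.le, h.le, not_lt.2]
  · filter_upwards [gt_mem_nhds h] with s hs
    simp [Set.indicator, hs, h]

end

variable {Ω : Type*} [mΩ : MeasurableSpace Ω] {P : Measure Ω} [IsProbabilityMeasure P] {T : ℝ}
  {F : Filtration (TimeSet T) mΩ}

theorem measurable_of_isProgressive {E : Type*} [MeasurableSpace E] {u : TimeSet T → Ω → E}
    (hu : IsProgressive F u) (t : TimeSet T) : Measurable[F t] (u t) :=
  hu.adapted t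

theorem enorm_le_one_add_sq (x : ℝ) : ‖x‖ₑ ≤ 1 + ‖x‖ₑ ^ 2 := by
  rcases le_total ‖x‖ₑ 1 with h | h
  · exact h.trans le_self_add
  · calc ‖x‖ₑ = ‖x‖ₑ * 1 := (mul_one _).symm
      _ ≤ ‖x‖ₑ * ‖x‖ₑ := by gcongr
      _ ≤ _ := by rw [sq]; exact le_add_self

theorem integrable_one_add_toReal {S : Ω → ℝ≥0∞} (hS : AEMeasurable S P)
    (hS' : ∫⁻ ω, S ω ∂P ≠ ∞) : Integrable (fun ω => 1 + (S ω).toReal) P :=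
  (integrable_const 1).add (integrable_toReal_of_lintegral_ne_top hS hS')

theorem IsS2.isDominated {w : TimeSet T → Ω → ℝ} (hw : IsS2 P F w) : IsDominated P w := by
  have hmeas : ∀ t, Measurable (w t) := fun t =>
    (measurable_of_isProgressive hw.progressive t).mono (F.le t) le_rfl
  refine ⟨hw.continuous, hmeas, ?_⟩
  -- By continuity the supremum may be taken over a countable dense set of times.
  set S : Ω → ℝ≥0∞ := fun ω => ⨆ t, ‖w t ω‖ₑ ^ 2 with hS
  have hSm : Measurable S := by
    rcases isEmpty_or_nonempty (TimeSet T) with he | he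
    · simp [hS]
    have : S = fun ω => ⨆ n, ‖w (TopologicalSpace.denseSeq (TimeSet T) n) ω‖ₑ ^ 2 := by
      ext ω
      refine le_antisymm (iSup_le fun t => ?_)
        (iSup_le fun n => le_iSup (fun t => ‖w t ω‖ₑ ^ 2) _)
      have hc : IsClosed {t | ‖w t ω‖ₑ ^ 2 ≤
          ⨆ n, ‖w (TopologicalSpace.denseSeq (TimeSet T) n) ω‖ₑ ^ 2} :=
        isClosed_le ((ENNReal.continuous_pow 2).comp (hw.continuous ω).enorm) continuous_const
      exact (TopologicalSpace.denseRange_denseSeq (TimeSet T)).induction_on t hc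
        fun n => le_iSup (fun n => ‖w (TopologicalSpace.denseSeq (TimeSet T) n) ω‖ₑ ^ 2) n
    rw [this]
    exact Measurable.iSup fun n => (hmeas _).enorm.pow_const 2
  refine ⟨_, integrable_one_add_toReal hSm.aemeasurable hw.sq_sup.ne, ?_⟩
  filter_upwards [ae_lt_top hSm hw.sq_sup.ne] with ω hω t
  have h1 : ‖w t ω‖ₑ ≤ 1 + S ω :=
    (enorm_le_one_add_sq _).trans (add_le_add le_rfl (le_iSup (fun t => ‖w t ω‖ₑ ^ 2) t))
  have h2 := ENNReal.toReal_mono (ENNReal.add_lt_top.2 ⟨ENNReal.one_lt_top, hω⟩).ne h1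
  rwa [ENNReal.toReal_add ENNReal.one_ne_top hω.ne, toReal_enorm, ENNReal.toReal_one,
    Real.norm_eq_abs] at h2

theorem IsM2.integrable_integral_abs {w : TimeSet T → Ω → ℝ} (hw : IsM2 P F w)
    (hc : ∀ ω, Continuous fun t => w t ω) : Integrable (fun ω => ∫ t, |w t ω|) P := by
  have hmeas : ∀ t, Measurable (w t) := fun t =>
    (measurable_of_isProgressive hw.progressive t).mono (F.le t) le_rfl
  have hm : Measurable fun p : Ω × TimeSet T => w p.2 p.1 :=
    (measurable_uncurry_of_continuous_of_measurable (u := w) hc hmeas).comp measurable_swap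
  have hsm : StronglyMeasurable fun ω => ∫ t, |w t ω| :=
    (hm.norm.stronglyMeasurable (β := ℝ)).integral_prod_right
  set S : Ω → ℝ≥0∞ := fun ω => ∫⁻ t, ‖w t ω‖ₑ ^ 2 with hS
  have hSm : Measurable S := (hm.enorm.pow_const 2).lintegral_prod_right
  have hdom := (integrable_const (volume.real (Set.univ : Set (TimeSet T)))).add
    (integrable_toReal_of_lintegral_ne_top hSm.aemeasurable hw.sq_int.ne)
  refine hdom.mono' hsm.aestronglyMeasurable ?_
  filter_upwards [ae_lt_top hSm hw.sq_int.ne] with ω hω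
  rw [Real.norm_of_nonneg (integral_nonneg fun t => abs_nonneg _)]
  have h1 : ∫⁻ t, ‖w t ω‖ₑ ≤ volume (Set.univ : Set (TimeSet T)) + S ω := by
    calc ∫⁻ t, ‖w t ω‖ₑ ≤ ∫⁻ t, (1 + ‖w t ω‖ₑ ^ 2) :=
          lintegral_mono fun t => enorm_le_one_add_sq _
      _ = _ := by rw [lintegral_add_left measurable_const]; simp [hS]
  have h2 := ENNReal.toReal_mono
    (ENNReal.add_lt_top.2 ⟨measure_lt_top _ _, hω⟩).ne h1
  rw [ENNReal.toReal_add (measure_ne_top _ _) hω.ne] at h2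
  simp_rw [← Real.norm_eq_abs]
  rw [integral_norm_eq_lintegral_enorm (hc ω).measurable.aestronglyMeasurable]
  exact h2

/-- Domination does not involve adaptedness, so the profit still to come is admitted as a
process. -/
theorem IsM2.isDominated_neg_tail {w : TimeSet T → Ω → ℝ} (hw : IsM2 P F w)
    (hc : ∀ ω, Continuous fun t => w t ω) :
    IsDominated P fun t ω => -∫ s in Set.Ioi t, w s ω := by
  have hmeas : ∀ t, Measurable (w t) := fun t =>
    (measurable_of_isProgressive hw.progressive t).mono (F.le t) le_rfl
  have hm : Measurable fun p : Ω × TimeSet T => w p.2 p.1 :=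
    (measurable_uncurry_of_continuous_of_measurable (u := w) hc hmeas).comp measurable_swap
  refine ⟨fun ω => (continuous_setIntegral_Ioi (integrable_of_continuous (hc ω))).neg, fun t =>
    ((hm.stronglyMeasurable (β := ℝ)).integral_prod_right (ν := volume.restrict _)).measurable.neg,
    _, hw.integrable_integral_abs hc, ae_of_all _ fun ω t => ?_⟩
  rw [abs_neg]
  exact (abs_integral_le_integral_abs).trans
    (setIntegral_le_integral (integrable_of_continuous (hc ω).abs)
      (ae_of_all _ fun s => abs_nonneg _))

/-! ### Essential suprema of directed families -/

omit [IsProbabilityMeasure P] in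
/-- The mean of the essential supremum of an upward directed family is approached by the means of
its members. -/
theorem IsEssSup.exists_integral_le_add {𝒢 : Set (Ω → ℝ)} {Z : Ω → ℝ} (hZ : IsEssSup P 𝒢 Z)
    (hZi : Integrable Z P) (hne : 𝒢.Nonempty) (hm : ∀ f ∈ 𝒢, Measurable f)
    (hi : ∀ f ∈ 𝒢, Integrable f P)
    (hdir : ∀ f ∈ 𝒢, ∀ f' ∈ 𝒢, ∃ k ∈ 𝒢, ∀ᵐ ω ∂P, f ω ⊔ f' ω ≤ k ω) {δ : ℝ} (hδ : 0 < δ) :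
    ∃ f ∈ 𝒢, ∫ ω, Z ω ∂P ≤ ∫ ω, f ω ∂P + δ := by
  obtain ⟨f₀, hf₀⟩ := hne
  have hle : ∀ f ∈ 𝒢, ∫ ω, f ω ∂P ≤ ∫ ω, Z ω ∂P := fun f hf =>
    integral_mono_ae (hi f hf) hZi (hZ.upper f hf)
  set I : Set ℝ := (fun f : Ω → ℝ => ∫ ω, f ω ∂P) '' 𝒢 with hI
  have hIne : I.Nonempty := ⟨_, f₀, hf₀, rfl⟩
  have hIb : BddAbove I := ⟨∫ ω, Z ω ∂P, by rintro _ ⟨f, hf, rfl⟩; exact hle f hf⟩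
  have hsup : ∀ f ∈ 𝒢, ∫ ω, f ω ∂P ≤ sSup I := fun f hf => le_csSup hIb ⟨f, hf, rfl⟩
  have hnear : ∀ n : ℕ, ∃ f ∈ 𝒢, sSup I - 1 / ((n : ℝ) + 1) < ∫ ω, f ω ∂P := fun n => by
    obtain ⟨_, ⟨f, hf, rfl⟩, h⟩ := exists_lt_of_lt_csSup hIne
      (sub_lt_self (sSup I) (Nat.one_div_pos_of_nat (α := ℝ) (n := n)))
    exact ⟨f, hf, h⟩
  choose a ha hnear using hnear
  choose join hjoin hjoin_le using hdir
  -- An almost surely increasing sequence in the family whose means approach the supremum.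
  let G : ℕ → {f // f ∈ 𝒢} := fun n => Nat.rec ⟨a 0, ha 0⟩
    (fun n f => ⟨join f.1 f.2 (a (n + 1)) (ha (n + 1)), hjoin _ _ _ _⟩) n
  have hGs : ∀ n, ∀ᵐ ω ∂P, (G n).1 ω ⊔ a (n + 1) ω ≤ (G (n + 1)).1 ω := fun n =>
    hjoin_le _ _ _ _
  have hGmono : ∀ᵐ ω ∂P, Monotone fun n => (G n).1 ω := by
    filter_upwards [ae_all_iff.2 hGs] with ω hω
    exact monotone_nat_of_le_succ fun n => le_sup_left.trans (hω n)
  have hGa : ∀ n : ℕ, sSup I - 1 / ((n : ℝ) + 1) ≤ ∫ ω, (G n).1 ω ∂P := fun n => by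
    refine (hnear n).le.trans ?_
    cases n with
    | zero => exact le_rfl
    | succ n =>
      exact integral_mono_ae (hi _ (ha _)) (hi _ (G (n + 1)).2)
        ((hGs n).mono fun ω h => le_sup_right.trans h)
  have hGZ : ∀ᵐ ω ∂P, ∀ n, (G n).1 ω ≤ Z ω := ae_all_iff.2 fun n => hZ.upper _ (G n).2
  set Z' : Ω → ℝ := fun ω => ⨆ n, (G n).1 ω with hZ'
  have hZ'm : Measurable Z' := Measurable.iSup fun n => hm _ (G n).2
  have hbdd : ∀ᵐ ω ∂P, BddAbove (Set.range fun n => (G n).1 ω) := by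
    filter_upwards [hGZ] with ω hω
    exact ⟨Z ω, by rintro _ ⟨n, rfl⟩; exact hω n⟩
  have hGZ' : ∀ᵐ ω ∂P, ∀ n, (G n).1 ω ≤ Z' ω := by
    filter_upwards [hbdd] with ω hω n
    exact le_ciSup hω n
  have hZ'Z : ∀ᵐ ω ∂P, Z' ω ≤ Z ω := by
    filter_upwards [hGZ] with ω hω
    exact ciSup_le hω
  have hZ'i : Integrable Z' P := by
    refine ((hi _ (G 0).2).norm.add hZi.norm).mono' hZ'm.aestronglyMeasurable ?_
    filter_upwards [hGZ', hZ'Z] with ω h1 h2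
    have h1 := h1 0
    simp only [Pi.add_apply, Real.norm_eq_abs]
    refine abs_le.2 ⟨?_, ?_⟩
    · linarith [neg_abs_le ((G 0).1 ω), abs_nonneg (Z ω)]
    · linarith [le_abs_self (Z ω), abs_nonneg ((G 0).1 ω)]
  have hlim : Tendsto (fun n => ∫ ω, (G n).1 ω ∂P) atTop (𝓝 (∫ ω, Z' ω ∂P)) := by
    refine integral_tendsto_of_tendsto_of_monotone (fun n => hi _ (G n).2) hZ'i hGmono ?_
    filter_upwards [hGmono, hbdd] with ω h1 h2
    exact tendsto_atTop_ciSup h1 h2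
  have hZ's : ∫ ω, Z' ω ∂P ≤ sSup I := le_of_tendsto' hlim fun n => hsup _ (G n).2
  -- A member exceeding `Z'` on a set of positive measure could be joined to the sequence.
  have hupper : ∀ f ∈ 𝒢, f ≤ᵐ[P] Z' := fun f hf => by
    have hpos : ∀ n : ℕ, ∫ ω, (f ω - Z' ω) ⊔ 0 ∂P ≤ 1 / ((n : ℝ) + 1) := fun n => by
      have hk := hjoin_le f hf _ (G n).2
      have hki := hi _ (hjoin f hf _ (G n).2)
      calc ∫ ω, (f ω - Z' ω) ⊔ 0 ∂P
          ≤ ∫ ω, (join f hf _ (G n).2 ω - (G n).1 ω) ∂P := by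
            refine integral_mono_ae (((hi f hf).sub hZ'i).pos_part) (hki.sub (hi _ (G n).2)) ?_
            filter_upwards [hk, hGZ'] with ω h1 h2
            have h3 := h2 n
            have h4 := le_sup_left.trans h1
            have h5 := le_sup_right.trans h1
            exact sup_le (by linarith) (by linarith)
        _ = ∫ ω, join f hf _ (G n).2 ω ∂P - ∫ ω, (G n).1 ω ∂P :=
            integral_sub hki (hi _ (G n).2)
        _ ≤ _ := by linarith [hsup _ (hjoin f hf _ (G n).2), hGa n]
    have h0 : ∫ ω, (f ω - Z' ω) ⊔ 0 ∂P ≤ 0 :=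
      ge_of_tendsto' tendsto_one_div_add_atTop_nhds_zero_nat hpos
    have h1 := (integral_eq_zero_iff_of_nonneg (μ := P) (f := fun ω => (f ω - Z' ω) ⊔ 0)
      (fun ω => le_sup_right) (((hi f hf).sub hZ'i).pos_part)).1
      (le_antisymm h0 (integral_nonneg fun ω => le_sup_right))
    filter_upwards [h1] with ω hω
    have : (f ω - Z' ω) ⊔ 0 = 0 := hω
    linarith [sup_eq_right.1 this]
  have hZle := integral_mono_ae hZi hZ'i (hZ.least Z' hZ'm hupper)
  obtain ⟨n, hn⟩ := exists_nat_one_div_lt hδ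
  exact ⟨a n, ha n, by linarith [hnear n]⟩

end OptimalSwitching

namespace OptimalSwitching

variable {Ω : Type*} [mΩ : MeasurableSpace Ω] {P : Measure Ω} [IsProbabilityMeasure P] {T : ℝ}
  {F : Filtration (TimeSet T) mΩ} {m k : ℕ}

/-! ### The value process of a fixed mode -/

/-- The part of the hypotheses on the switching problem that does not refer to the Brownian motion
generating the filtration. -/
structure IsSwitchingSystem (P : Measure Ω) (F : Filtration (TimeSet T) mΩ)
    (ψ : Fin m → TimeSet T → EuclideanSpace ℝ (Fin k) → ℝ)
    (g : Fin m → Fin m → TimeSet T → EuclideanSpace ℝ (Fin k) → ℝ)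
    (X : TimeSet T → Ω → EuclideanSpace ℝ (Fin k)) (Y : Fin m → TimeSet T → Ω → ℝ) : Prop where
  horizon_pos : 0 < T
  two_le : 2 ≤ m
  coeff : CoefficientAssumptions ψ g
  continuous_state : ∀ ω, Continuous fun t => X t ω
  profit : ∀ i, IsM2 P F fun t ω => ψ i t (X t ω)
  cost : ∀ i j, IsS2 P F fun t ω => g i j t (X t ω)
  value : ∀ i, IsS2 P F (Y i)
  snell : IsSnellSystem P F ψ g X Y

/-- The process `-∫_t^T ψ_i(s, X_s) ds`. It serves as running reward in mode `i`: its increments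
are those of `∫_0^t ψ_i(s, X_s) ds`, and it vanishes at the horizon. -/
noncomputable def negTail (ψ : Fin m → TimeSet T → EuclideanSpace ℝ (Fin k) → ℝ)
    (X : TimeSet T → Ω → EuclideanSpace ℝ (Fin k)) (i : Fin m) (t : TimeSet T) (ω : Ω) : ℝ :=
  -∫ s in Set.Ioi t, ψ i s (X s ω)

namespace IsSwitchingSystem

variable {ψ : Fin m → TimeSet T → EuclideanSpace ℝ (Fin k) → ℝ}
  {g : Fin m → Fin m → TimeSet T → EuclideanSpace ℝ (Fin k) → ℝ}
  {X : TimeSet T → Ω → EuclideanSpace ℝ (Fin k)} {Y : Fin m → TimeSet T → Ω → ℝ}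

omit [IsProbabilityMeasure P] in
theorem nonempty_ne (H : IsSwitchingSystem P F ψ g X Y) (i : Fin m) : Nonempty {j // j ≠ i} := by
  have : Nontrivial (Fin m) := Fin.nontrivial_iff_two_le.2 H.two_le
  obtain ⟨j, hj⟩ := exists_ne i
  exact ⟨⟨j, hj⟩⟩

omit [IsProbabilityMeasure P] in
theorem continuous_profit (H : IsSwitchingSystem P F ψ g X Y) (i : Fin m) (ω : Ω) :
    Continuous fun t => ψ i t (X t ω) :=
  (H.coeff.continuous_profit i).comp (continuous_id.prodMk (H.continuous_state ω))

theorem isDominated_negTail (H : IsSwitchingSystem P F ψ g X Y) (i : Fin m) :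
    IsDominated P (negTail ψ X i) :=
  (H.profit i).isDominated_neg_tail (H.continuous_profit i)

theorem isDominated_obstacle (H : IsSwitchingSystem P F ψ g X Y) (i : Fin m) :
    IsDominated P (obstacle g X Y i) := by
  have := H.nonempty_ne i
  exact IsDominated.iSup fun j : {j // j ≠ i} =>
    (H.cost i j).isDominated.neg.add (H.value j).isDominated

omit [IsProbabilityMeasure P] in
theorem measurable_obstacle (H : IsSwitchingSystem P F ψ g X Y) (i : Fin m) (t : TimeSet T) :
    Measurable[F t] (obstacle g X Y i t) :=
  Measurable.iSup fun j : {j // j ≠ i} =>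
    (measurable_of_isProgressive (H.cost i j).progressive t).neg.add
      (measurable_of_isProgressive (H.value j).progressive t)

omit [IsProbabilityMeasure P] in
theorem terminal (H : IsSwitchingSystem P F ψ g X Y) :
    ∀ᵐ ω ∂P, ∀ i, ∀ t : TimeSet T, (t : ℝ) = T → Y i t ω = 0 := by
  have h := ae_all_iff.2 fun i => (H.snell i).2 ⟨T, H.horizon_pos.le, le_rfl⟩ rfl
  filter_upwards [h] with ω hω i t ht
  have : t = ⟨T, H.horizon_pos.le, le_rfl⟩ := Subtype.ext ht
  rw [this, hω]

omit [IsProbabilityMeasure P] in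
/-- The reward of the Snell envelope at time `t` is the stopping reward, up to a term that does
not depend on the stopping time. -/
theorem reward_eq (H : IsSwitchingSystem P F ψ g X Y) (i : Fin m) {t : TimeSet T}
    {τ : Ω → TimeSet T} (hτ : ∀ ω, t ≤ τ ω) :
    (fun ω => (∫ s in Set.Ioc t (τ ω), ψ i s (X s ω)) +
        (if (τ ω : ℝ) < T then obstacle g X Y i (τ ω) ω else 0)) =
      fun ω => stopReward (negTail ψ X i) (obstacle g X Y i) (τ ω) ω - negTail ψ X i t ω := by
  ext ω
  rw [setIntegral_Ioc_eq_sub (integrable_of_continuous (H.continuous_profit i ω)) (hτ ω)]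
  simp only [stopReward, negTail]
  ring

theorem integrable_reward (H : IsSwitchingSystem P F ψ g X Y) (i : Fin m) (t : TimeSet T)
    {τ : Ω → TimeSet T} (hτ : IsStop F τ) :
    Integrable (fun ω => stopReward (negTail ψ X i) (obstacle g X Y i) (τ ω) ω -
      negTail ψ X i t ω) P :=
  (integrable_stopReward (H.isDominated_negTail i) (H.isDominated_obstacle i) hτ.measurable).sub
    ((H.isDominated_negTail i).integrable t)

omit [IsProbabilityMeasure P] in
theorem condExp_reward_le (H : IsSwitchingSystem P F ψ g X Y) (i : Fin m) (t : TimeSet T)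
    {τ : Ω → TimeSet T} (hτ : IsStop F τ) (htτ : ∀ ω, t ≤ τ ω) :
    P[fun ω => stopReward (negTail ψ X i) (obstacle g X Y i) (τ ω) ω -
      negTail ψ X i t ω | F t] ≤ᵐ[P] Y i t := by
  rw [← H.reward_eq i htτ]
  exact ((H.snell i).1 t).upper _ ⟨τ, hτ, htτ, rfl⟩

theorem setIntegral_reward_le (H : IsSwitchingSystem P F ψ g X Y) (i : Fin m) (t : TimeSet T)
    {τ : Ω → TimeSet T} (hτ : IsStop F τ) (htτ : ∀ ω, t ≤ τ ω) {A : Set Ω}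
    (hA : MeasurableSet[F t] A) :
    ∫ ω in A, stopReward (negTail ψ X i) (obstacle g X Y i) (τ ω) ω ∂P ≤
      ∫ ω in A, (Y i t ω + negTail ψ X i t ω) ∂P := by
  have hi := H.integrable_reward i t hτ
  have h1 := setIntegral_condExp (F.le t) hi hA
  have h2 : ∫ ω in A, (P[fun ω => stopReward (negTail ψ X i) (obstacle g X Y i) (τ ω) ω -
      negTail ψ X i t ω | F t]) ω ∂P ≤ ∫ ω in A, Y i t ω ∂P :=
    setIntegral_mono_ae integrable_condExp.integrableOn
      ((H.value i).isDominated.integrable t).integrableOn (H.condExp_reward_le i t hτ htτ)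
  rw [h1, integral_sub (integrable_stopReward (H.isDominated_negTail i)
    (H.isDominated_obstacle i) hτ.measurable).integrableOn
    ((H.isDominated_negTail i).integrable t).integrableOn] at h2
  rw [integral_add ((H.value i).isDominated.integrable t).integrableOn
    ((H.isDominated_negTail i).integrable t).integrableOn]
  linarith

theorem obstacle_le (H : IsSwitchingSystem P F ψ g X Y) (i : Fin m) :
    ∀ᵐ ω ∂P, ∀ t, obstacle g X Y i t ω ≤ Y i t ω := by
  have := H.nonempty_ne i
  have hfix : ∀ t : TimeSet T, ∀ᵐ ω ∂P, obstacle g X Y i t ω ≤ Y i t ω := fun t => by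
    rcases lt_or_ge (t : ℝ) T with ht | ht
    · have h1 := H.condExp_reward_le i t (isStop_const t) fun _ => le_rfl
      have h2 : (fun ω => stopReward (negTail ψ X i) (obstacle g X Y i) t ω -
          negTail ψ X i t ω) = obstacle g X Y i t := by
        ext ω
        simp [stopReward, ht]
      rw [h2, condExp_of_stronglyMeasurable (F.le t) (H.measurable_obstacle i t).stronglyMeasurable
        ((H.isDominated_obstacle i).integrable t)] at h1
      exact h1
    · filter_upwards [H.terminal] with ω hω
      have hT := le_antisymm t.2.2 ht
      rw [hω i t hT]
      refine ciSup_le fun j => ?_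
      rw [hω j t hT, add_zero, neg_nonpos]
      exact H.coeff.cost_nonneg _ _ _ _
  have : Nonempty (TimeSet T) := ⟨⟨T, H.horizon_pos.le, le_rfl⟩⟩
  filter_upwards [ae_all_iff.2 fun n => hfix (TopologicalSpace.denseSeq (TimeSet T) n)] with ω hω t
  exact (TopologicalSpace.denseRange_denseSeq (TimeSet T)).induction_on t
    (isClosed_le ((H.isDominated_obstacle i).continuous ω) ((H.value i).continuous ω)) hω

theorem exists_near_optimal (H : IsSwitchingSystem P F ψ g X Y) (i : Fin m) (t : TimeSet T)
    {δ : ℝ} (hδ : 0 < δ) : ∃ τ : Ω → TimeSet T, IsStop F τ ∧ (∀ ω, t ≤ τ ω) ∧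
      ∫ ω, (Y i t ω + negTail ψ X i t ω) ∂P ≤
        ∫ ω, stopReward (negTail ψ X i) (obstacle g X Y i) (τ ω) ω ∂P + δ := by
  set R : (Ω → TimeSet T) → Ω → ℝ := fun τ ω =>
    stopReward (negTail ψ X i) (obstacle g X Y i) (τ ω) ω - negTail ψ X i t ω with hR
  have hmem : ∀ f, (∃ τ : Ω → TimeSet T, IsStop F τ ∧ (∀ ω, t ≤ τ ω) ∧
      f = P[fun ω => (∫ s in Set.Ioc t (τ ω), ψ i s (X s ω)) +
          (if (τ ω : ℝ) < T then obstacle g X Y i (τ ω) ω else 0) | F t]) ↔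
      ∃ τ : Ω → TimeSet T, IsStop F τ ∧ (∀ ω, t ≤ τ ω) ∧ f = P[R τ | F t] := fun f =>
    exists_congr fun τ => and_congr_right fun _ => and_congr_right fun h => by
      rw [H.reward_eq i h]
  have hsup := (H.snell i).1 t
  simp_rw [hmem] at hsup
  obtain ⟨_, ⟨τ, hτ, htτ, rfl⟩, h⟩ := hsup.exists_integral_le_add
    ((H.value i).isDominated.integrable t) ⟨_, fun _ => t, isStop_const t, fun _ => le_rfl, rfl⟩
    (by
      rintro _ ⟨τ, hτ, htτ, rfl⟩
      exact (stronglyMeasurable_condExp.mono (F.le t)).measurable)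
    (by
      rintro _ ⟨τ, hτ, htτ, rfl⟩
      exact integrable_condExp)
    (by
      -- Follow the stopping time whose conditional reward is larger.
      rintro _ ⟨τ, hτ, htτ, rfl⟩ _ ⟨τ', hτ', htτ', rfl⟩
      classical
      set A : Set Ω := {ω | (P[R τ' | F t]) ω ≤ (P[R τ | F t]) ω} with hA
      have hAm : MeasurableSet[F t] A :=
        stronglyMeasurable_condExp.measurableSet_le stronglyMeasurable_condExp
      let κ : Ω → Bool := fun ω => decide (ω ∈ A)
      have hκ : ∀ b, MeasurableSet[F t] {ω | κ ω = b} := fun b => by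
        cases b
        · convert hAm.compl using 1
          ext ω
          simp [κ]
        · convert hAm using 1
          ext ω
          simp [κ]
      let τb : Bool → Ω → TimeSet T := fun b => cond b τ τ'
      have hτb : ∀ b, IsStop F (τb b) := by rintro (_ | _) <;> assumption
      have htτb : ∀ b ω, t ≤ τb b ω := by rintro (_ | _) <;> assumption
      have hρ := isStop_choice (p := fun _ => t) hκ hτb htτb
      refine ⟨_, ⟨fun ω => τb (κ ω) ω, hρ, fun ω => htτb _ ω, rfl⟩, ?_⟩
      have hloc : ∀ b, ∀ᵐ ω ∂P, κ ω = b →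
          (P[R (fun ω => τb (κ ω) ω) | F t]) ω = (P[R (τb b) | F t]) ω := fun b => by
        have h1 := condExp_indicator (H.integrable_reward i t hρ) (hκ b)
        have h2 := condExp_indicator (H.integrable_reward i t (hτb b)) (hκ b)
        have h3 : {ω | κ ω = b}.indicator (R fun ω => τb (κ ω) ω) =
            {ω | κ ω = b}.indicator (R (τb b)) := by
          ext ω
          by_cases hω : κ ω = b <;> simp [hω, hR]
        have h3' := h3
        simp only [hR] at h3'
        rw [h3'] at h1
        filter_upwards [h1, h2] with ω h1 h2 hω
        rw [h1] at h2
        simpa [Set.indicator, hω] using h2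
      filter_upwards [hloc true, hloc false] with ω h1 h2
      by_cases hω : ω ∈ A
      · rw [h1 (by simp [κ, hω])]
        exact sup_le le_rfl hω
      · rw [h2 (by simp [κ, hω])]
        exact sup_le (not_le.1 hω).le le_rfl) hδ
  refine ⟨τ, hτ, htτ, ?_⟩
  rw [integral_condExp (F.le t), integral_sub (integrable_stopReward (H.isDominated_negTail i)
    (H.isDominated_obstacle i) hτ.measurable) ((H.isDominated_negTail i).integrable t)] at h
  rw [integral_add ((H.value i).isDominated.integrable t) ((H.isDominated_negTail i).integrable t)]
  linarith

theorem isEnvelope (H : IsSwitchingSystem P F ψ g X Y) (i : Fin m) :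
    IsEnvelope P F (Y i) (obstacle g X Y i) (negTail ψ X i) where
  value := (H.value i).isDominated
  obstacle := H.isDominated_obstacle i
  running := H.isDominated_negTail i
  terminal := H.terminal.mono fun _ h => h i
  obstacle_le := H.obstacle_le i
  setIntegral_reward_le := fun t _ hτ htτ _ hA => H.setIntegral_reward_le i t hτ htτ hA
  exists_near_optimal := fun t _ hδ => H.exists_near_optimal i t hδ

end IsSwitchingSystem

end OptimalSwitching

namespace OptimalSwitching

/-! ### Infinitely many switches are infinitely expensive -/

/-- If the costs of successive switches at converging points tend to zero, then the sequence of
modes is eventually constant: the costs at the limit point take finitely many values, so they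
vanish eventually, and by the triangle inequality a recurring change of mode would give a loop
without cost. -/
theorem exists_eventually_eq_of_tendsto_cost {ι E : Type*} [Finite ι] [TopologicalSpace E]
    {G : ι → ι → E → ℝ} {x : E} (hG : ∀ i j, ContinuousAt (G i j) x)
    (hself : ∀ i, G i i x = 0)
    (htri : ∀ i j l, j ≠ i → l ≠ j → G i l x < G i j x + G j l x)
    (hloop : ∀ i j, i ≠ j → 0 < G i j x + G j i x)
    {p : ℕ → E} (hp : Tendsto p atTop (𝓝 x)) {ξ : ℕ → ι}
    (hc : Tendsto (fun n => G (ξ n) (ξ (n + 1)) (p n)) atTop (𝓝 0)) :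
    ∃ i, ∀ᶠ n in atTop, ξ n = i := by
  have htri' : ∀ i j l, G i l x ≤ G i j x + G j l x := fun i j l => by
    by_cases h1 : j = i
    · simp [h1, hself]
    by_cases h2 : l = j
    · simp [h2, hself]
    exact (htri i j l h1 h2).le
  have hev : ∀ᶠ n in atTop, ∀ i j, 0 < G i j x →
      G i j x / 2 < G i j (p n) ∧ G (ξ n) (ξ (n + 1)) (p n) < G i j x / 2 := by
    refine eventually_all.2 fun i => eventually_all.2 fun j => ?_
    by_cases h : 0 < G i j x
    · filter_upwards [((hG i j).tendsto.comp hp).eventually (lt_mem_nhds (half_lt_self h)),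
        hc.eventually (gt_mem_nhds (half_pos h))] with n h1 h2 _
      exact ⟨h1, h2⟩
    · exact Eventually.of_forall fun n h' => absurd h' h
  obtain ⟨N, hN⟩ := eventually_atTop.1 hev
  have hstep : ∀ n ≥ N, G (ξ n) (ξ (n + 1)) x ≤ 0 := fun n hn => by
    by_contra h
    obtain ⟨h1, h2⟩ := hN n hn _ _ (not_le.1 h)
    exact lt_asymm h1 h2
  have hpath : ∀ a ≥ N, ∀ b ≥ a, G (ξ a) (ξ b) x ≤ 0 := fun a ha b hb => by
    induction b, hb using Nat.le_induction with
    | base => rw [hself]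
    | succ b hb ih => linarith [htri' (ξ a) (ξ b) (ξ (b + 1)), hstep b (ha.trans hb)]
  have hrec : ∃ i, ∃ᶠ n in atTop, ξ n = i := by
    by_contra! h
    obtain ⟨n, hn⟩ := (eventually_all.2 h).exists
    exact hn (ξ n) rfl
  obtain ⟨i, hi⟩ := hrec
  obtain ⟨a, ha, rfl⟩ := frequently_atTop.1 hi N
  refine ⟨ξ a, eventually_atTop.2 ⟨a, fun b hb => ?_⟩⟩
  by_contra hne
  obtain ⟨c, hcb, hc'⟩ := frequently_atTop.1 hi b
  have h1 := hpath a ha b hb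
  have h2 := hpath b (le_trans ha hb) c hcb
  rw [hc'] at h2
  linarith [hloop _ _ hne]

variable {Ω : Type*} [mΩ : MeasurableSpace Ω] {P : Measure Ω} [IsProbabilityMeasure P] {T : ℝ}
  {F : Filtration (TimeSet T) mΩ} {m k : ℕ}

/-! ### Processes read along a random mode -/

section

variable {u : Fin m → TimeSet T → Ω → ℝ} {κ : Ω → Fin m} {τ : Ω → TimeSet T}

omit [IsProbabilityMeasure P] in
theorem measurable_mode_comp (hu : ∀ i, IsDominated P (u i)) (hκ : Measurable κ)
    (hτ : Measurable τ) : Measurable fun ω => u (κ ω) (τ ω) ω :=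
  (measurable_from_prod_countable_right (f := fun p : Fin m × Ω => u p.1 (τ p.2) p.2)
    fun i => (hu i).measurable_comp hτ).comp (hκ.prodMk measurable_id)

omit [IsProbabilityMeasure P] in
theorem exists_bound_family (hu : ∀ i, IsDominated P (u i)) :
    ∃ W : Ω → ℝ, Integrable W P ∧ ∀ᵐ ω ∂P, ∀ i t, |u i t ω| ≤ W ω := by
  choose W hW hb using fun i => (hu i).bound
  refine ⟨fun ω => ∑ i, W i ω, integrable_finsetSum _ fun i _ => hW i, ?_⟩
  filter_upwards [ae_all_iff.2 hb] with ω h i t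
  exact (h i t).trans (Finset.single_le_sum (f := fun i => W i ω)
    (fun j _ => (abs_nonneg _).trans (h j t)) (Finset.mem_univ i))

omit [IsProbabilityMeasure P] in
theorem integrable_mode_comp (hu : ∀ i, IsDominated P (u i)) (hκ : Measurable κ)
    (hτ : Measurable τ) : Integrable (fun ω => u (κ ω) (τ ω) ω) P := by
  obtain ⟨W, hW, hb⟩ := exists_bound_family hu
  exact hW.mono' (measurable_mode_comp hu hκ hτ).aestronglyMeasurable
    (hb.mono fun ω h => h (κ ω) (τ ω))

omit [IsProbabilityMeasure P] in
theorem integral_mode_comp (hu : ∀ i, IsDominated P (u i)) (hκ : Measurable κ)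
    (hτ : Measurable τ) :
    ∫ ω, u (κ ω) (τ ω) ω ∂P = ∑ i, ∫ ω in {ω | κ ω = i}, u i (τ ω) ω ∂P := by
  have hm : ∀ i, MeasurableSet {ω | κ ω = i} := fun i => hκ (measurableSet_singleton i)
  rw [integral_eq_sum_setIntegral hm (integrable_mode_comp hu hκ hτ)]
  refine Finset.sum_congr rfl fun i _ => setIntegral_congr_fun (hm i) fun ω hω => ?_
  have hω : κ ω = i := hω
  simp only [hω]

end

/-! ### Strategies stopped after finitely many switches -/

namespace Strategy

variable {i₀ : Fin m} {ψ : Fin m → TimeSet T → EuclideanSpace ℝ (Fin k) → ℝ}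
  {g : Fin m → Fin m → TimeSet T → EuclideanSpace ℝ (Fin k) → ℝ}
  {X : TimeSet T → Ω → EuclideanSpace ℝ (Fin k)} {Y : Fin m → TimeSet T → Ω → ℝ}

theorem measurable_mode (S : Strategy F i₀) (n : ℕ) : Measurable (S.mode n) :=
  (S.mode_measurable n).mono (IsStoppingTime.measurableSpace_le (S.isStop n)) le_rfl

theorem measurable_time (S : Strategy F i₀) (n : ℕ) : Measurable (S.time n) :=
  (S.isStop n).measurable

theorem monotone_time (S : Strategy F i₀) (ω : Ω) : Monotone fun n => S.time n ω :=
  monotone_nat_of_le_succ fun n => S.time_le_succ n ω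

/-- The cost `g_{ξ_n ξ_{n+1}}(τ_{n+1}, X_{τ_{n+1}}) 1_{τ_{n+1} < T}` of the switch at
`τ_{n+1}`. -/
noncomputable def stepCost (S : Strategy F i₀)
    (g : Fin m → Fin m → TimeSet T → EuclideanSpace ℝ (Fin k) → ℝ)
    (X : TimeSet T → Ω → EuclideanSpace ℝ (Fin k)) (n : ℕ) (ω : Ω) : ℝ :=
  if (S.time (n + 1) ω : ℝ) < T then
    g (S.mode n ω) (S.mode (n + 1) ω) (S.time (n + 1) ω) (X (S.time (n + 1) ω) ω) else 0

/-- The profit rate at time `s` when the strategy is followed through its first `n` switches and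
the mode is kept afterwards. -/
noncomputable def truncRate (S : Strategy F i₀)
    (ψ : Fin m → TimeSet T → EuclideanSpace ℝ (Fin k) → ℝ)
    (X : TimeSet T → Ω → EuclideanSpace ℝ (Fin k)) : ℕ → Ω → TimeSet T → ℝ
  | 0, ω, s => ψ (S.mode 0 ω) s (X s ω)
  | n + 1, ω, s => if s ≤ S.time (n + 1) ω then S.truncRate ψ X n ω s
      else ψ (S.mode (n + 1) ω) s (X s ω)

/-- The running profit of the strategy stopped after `n` switches. -/
noncomputable def truncGain (S : Strategy F i₀)
    (ψ : Fin m → TimeSet T → EuclideanSpace ℝ (Fin k) → ℝ)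
    (X : TimeSet T → Ω → EuclideanSpace ℝ (Fin k)) (n : ℕ) (ω : Ω) : ℝ :=
  ∫ s, S.truncRate ψ X n ω s

theorem truncRate_of_lt (S : Strategy F i₀) {n : ℕ} {ω : Ω} {s : TimeSet T}
    (h : S.time n ω < s) : S.truncRate ψ X n ω s = ψ (S.mode n ω) s (X s ω) := by
  cases n with
  | zero => rfl
  | succ n => simp [truncRate, h]

theorem truncRate_succ_of_le (S : Strategy F i₀) {n : ℕ} {ω : Ω} {s : TimeSet T}
    (h : s ≤ S.time (n + 1) ω) : S.truncRate ψ X (n + 1) ω s = S.truncRate ψ X n ω s := by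
  simp [truncRate, h]

theorem abs_truncRate_le (S : Strategy F i₀) (n : ℕ) (ω : Ω) (s : TimeSet T) :
    |S.truncRate ψ X n ω s| ≤ ∑ i, |ψ i s (X s ω)| := by
  have key : ∀ i, |ψ i s (X s ω)| ≤ ∑ i, |ψ i s (X s ω)| := fun i =>
    Finset.single_le_sum (f := fun i => |ψ i s (X s ω)|) (fun j _ => abs_nonneg _)
      (Finset.mem_univ i)
  induction n with
  | zero => exact key _
  | succ n ih =>
    rw [truncRate]
    split_ifs
    · exact ih
    · exact key _

/-- On the event that the time `T` is reached or the modes become stationary, the truncated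
profit rates are eventually equal to the profit rate of the strategy. -/
theorem eventually_truncRate_eq (S : Strategy F i₀) {ω : Ω} {s : TimeSet T}
    (hω : (∃ n, (S.time n ω : ℝ) = T) ∨ ∃ i, ∀ᶠ n in atTop, S.mode n ω = i) :
    ∀ᶠ n in atTop, S.truncRate ψ X n ω s = ψ (S.currentMode s ω) s (X s ω) := by
  classical
  by_cases h : ∃ n, s ≤ S.time (n + 1) ω
  · have hmode : S.currentMode s ω = S.mode (Nat.find h) ω := by
      simp only [currentMode, dif_pos h]
    rw [hmode]
    have hspec := Nat.find_spec h
    have hstart : S.truncRate ψ X (Nat.find h) ω s = ψ (S.mode (Nat.find h) ω) s (X s ω) := by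
      rcases hn : Nat.find h with _ | n
      · rfl
      · exact S.truncRate_of_lt (not_le.1 (Nat.find_min h (by omega)))
    filter_upwards [eventually_ge_atTop (Nat.find h)] with n hn
    induction n, hn using Nat.le_induction with
    | base => exact hstart
    | succ n hn ih =>
      rw [S.truncRate_succ_of_le (hspec.trans (S.monotone_time ω (Nat.succ_le_succ hn))), ih]
  · have hlt : ∀ n, S.time (n + 1) ω < s := fun n => not_le.1 fun h' => h ⟨n, h'⟩
    have hconst : ∃ i, ∀ᶠ n in atTop, S.mode n ω = i := by
      rcases hω with ⟨n, hn⟩ | h'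
      · refine absurd (hlt n) (not_lt.2 ?_)
        exact (Subtype.coe_le_coe.1 (s.2.2.trans hn.ge)).trans (S.time_le_succ n ω)
      · exact h'
    have hmode : S.currentMode s ω = hconst.choose := by
      simp only [currentMode, dif_neg h, dif_pos hconst]
    filter_upwards [hconst.choose_spec] with n hn
    have hn' : S.time n ω < s := (S.time_le_succ n ω).trans_lt (hlt n)
    rw [S.truncRate_of_lt hn', hmode, hn]

/-- The mean total value after `n` switches: the mean profit of the truncated strategy, minus the
mean cost of the first `n` switches, plus the mean value net of the profit still to come in the
last mode. -/
noncomputable def meanValue (S : Strategy F i₀) (P : Measure Ω)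
    (ψ : Fin m → TimeSet T → EuclideanSpace ℝ (Fin k) → ℝ)
    (g : Fin m → Fin m → TimeSet T → EuclideanSpace ℝ (Fin k) → ℝ)
    (X : TimeSet T → Ω → EuclideanSpace ℝ (Fin k)) (Y : Fin m → TimeSet T → Ω → ℝ) (n : ℕ) : ℝ :=
  ∫ ω, S.truncGain ψ X n ω ∂P - ∑ l ∈ Finset.range n, ∫ ω, S.stepCost g X l ω ∂P +
    ∫ ω, (Y (S.mode n ω) (S.time n ω) ω + negTail ψ X (S.mode n ω) (S.time n ω) ω) ∂P

end Strategy

namespace IsSwitchingSystem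

variable {i₀ : Fin m} {ψ : Fin m → TimeSet T → EuclideanSpace ℝ (Fin k) → ℝ}
  {g : Fin m → Fin m → TimeSet T → EuclideanSpace ℝ (Fin k) → ℝ}
  {X : TimeSet T → Ω → EuclideanSpace ℝ (Fin k)} {Y : Fin m → TimeSet T → Ω → ℝ}

omit [IsProbabilityMeasure P] in
theorem measurable_truncRate (H : IsSwitchingSystem P F ψ g X Y) (S : Strategy F i₀) (n : ℕ)
    (ω : Ω) : Measurable (S.truncRate ψ X n ω) := by
  induction n with
  | zero => exact (H.continuous_profit _ ω).measurable
  | succ n ih =>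
    exact Measurable.ite measurableSet_Iic ih (H.continuous_profit _ ω).measurable

omit [IsProbabilityMeasure P] in
theorem integrable_sum_abs_profit (H : IsSwitchingSystem P F ψ g X Y) (ω : Ω) :
    Integrable fun s => ∑ i, |ψ i s (X s ω)| :=
  integrable_finsetSum _ fun i _ => integrable_of_continuous (H.continuous_profit i ω).abs

omit [IsProbabilityMeasure P] in
theorem integrable_truncRate (H : IsSwitchingSystem P F ψ g X Y) (S : Strategy F i₀) (n : ℕ)
    (ω : Ω) : Integrable (S.truncRate ψ X n ω) :=
  (H.integrable_sum_abs_profit ω).mono' (H.measurable_truncRate S n ω).aestronglyMeasurable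
    (ae_of_all _ fun s => S.abs_truncRate_le n ω s)

theorem exists_truncGain_bound (H : IsSwitchingSystem P F ψ g X Y) :
    ∃ W : Ω → ℝ, Integrable W P ∧ ∀ (S : Strategy F i₀) n ω, |S.truncGain ψ X n ω| ≤ W ω := by
  refine ⟨fun ω => ∑ i, ∫ s, |ψ i s (X s ω)|, integrable_finsetSum _ fun i _ =>
    (H.profit i).integrable_integral_abs (H.continuous_profit i), fun S n ω => ?_⟩
  beta_reduce
  rw [← integral_finsetSum _ fun i _ => integrable_of_continuous (H.continuous_profit i ω).abs]
  exact abs_integral_le_integral_abs.trans (integral_mono (H.integrable_truncRate S n ω).abs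
    (H.integrable_sum_abs_profit ω) fun s => S.abs_truncRate_le n ω s)

omit [IsProbabilityMeasure P] in
theorem truncGain_zero (S : Strategy F i₀) (ω : Ω) :
    S.truncGain ψ X 0 ω = -negTail ψ X (S.mode 0 ω) (S.time 0 ω) ω := by
  rw [negTail, neg_neg, setIntegral_Ioi_of_eq_zero _ (S.time_zero ω)]
  rfl

omit [IsProbabilityMeasure P] in
theorem truncGain_succ (H : IsSwitchingSystem P F ψ g X Y) (S : Strategy F i₀) (n : ℕ) (ω : Ω) :
    S.truncGain ψ X (n + 1) ω = S.truncGain ψ X n ω +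
      negTail ψ X (S.mode n ω) (S.time (n + 1) ω) ω -
        negTail ψ X (S.mode (n + 1) ω) (S.time (n + 1) ω) ω := by
  have hi := fun i => integrable_of_continuous (H.continuous_profit i ω)
  have hr := fun n => H.integrable_truncRate S n ω
  simp only [Strategy.truncGain, negTail]
  rw [← integral_add_compl (measurableSet_Ioi (a := S.time (n + 1) ω)) (hr (n + 1)),
    ← integral_add_compl (measurableSet_Ioi (a := S.time (n + 1) ω)) (hr n)]
  have h1 : ∫ s in Set.Ioi (S.time (n + 1) ω), S.truncRate ψ X (n + 1) ω s =
      ∫ s in Set.Ioi (S.time (n + 1) ω), ψ (S.mode (n + 1) ω) s (X s ω) :=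
    setIntegral_congr_fun measurableSet_Ioi fun s hs => S.truncRate_of_lt hs
  have h2 : ∫ s in Set.Ioi (S.time (n + 1) ω), S.truncRate ψ X n ω s =
      ∫ s in Set.Ioi (S.time (n + 1) ω), ψ (S.mode n ω) s (X s ω) :=
    setIntegral_congr_fun measurableSet_Ioi fun s hs =>
      S.truncRate_of_lt ((S.time_le_succ n ω).trans_lt hs)
  have h3 : ∫ s in (Set.Ioi (S.time (n + 1) ω))ᶜ, S.truncRate ψ X (n + 1) ω s =
      ∫ s in (Set.Ioi (S.time (n + 1) ω))ᶜ, S.truncRate ψ X n ω s :=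
    setIntegral_congr_fun measurableSet_Ioi.compl fun s hs =>
      S.truncRate_succ_of_le (not_lt.1 hs)
  rw [h1, h2, h3]
  ring

theorem measurable_truncGain (H : IsSwitchingSystem P F ψ g X Y) (S : Strategy F i₀) (n : ℕ) :
    Measurable (S.truncGain ψ X n) := by
  have hN := H.isDominated_negTail
  induction n with
  | zero =>
    rw [show S.truncGain ψ X 0 = _ from funext fun ω => truncGain_zero S ω]
    exact (measurable_mode_comp hN (S.measurable_mode 0) (S.measurable_time 0)).neg
  | succ n ih =>
    rw [show S.truncGain ψ X (n + 1) = _ from funext fun ω => H.truncGain_succ S n ω]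
    exact (ih.add (measurable_mode_comp hN (S.measurable_mode n) (S.measurable_time (n + 1)))).sub
      (measurable_mode_comp hN (S.measurable_mode (n + 1)) (S.measurable_time (n + 1)))

theorem integrable_truncGain (H : IsSwitchingSystem P F ψ g X Y) (S : Strategy F i₀) (n : ℕ) :
    Integrable (S.truncGain ψ X n) P := by
  obtain ⟨W, hW, hb⟩ := H.exists_truncGain_bound (i₀ := i₀)
  exact hW.mono' (H.measurable_truncGain S n).aestronglyMeasurable (ae_of_all _ fun ω => hb S n ω)

omit [IsProbabilityMeasure P] in
theorem stepCost_nonneg (H : IsSwitchingSystem P F ψ g X Y) (S : Strategy F i₀) (n : ℕ) (ω : Ω) :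
    0 ≤ S.stepCost g X n ω := by
  unfold Strategy.stepCost
  split_ifs
  · exact H.coeff.cost_nonneg _ _ _ _
  · exact le_rfl

theorem integrable_stepCost (H : IsSwitchingSystem P F ψ g X Y) (S : Strategy F i₀) (n : ℕ) :
    Integrable (S.stepCost g X n) P := by
  have hc := fun i j => (H.cost i j).isDominated
  have hpair : ∀ ω, S.stepCost g X n ω = ∑ i, {ω | S.mode n ω = i}.indicator
      ({ω | (S.time (n + 1) ω : ℝ) < T}.indicator fun ω =>
        g i (S.mode (n + 1) ω) (S.time (n + 1) ω) (X (S.time (n + 1) ω) ω)) ω := fun ω => by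
    rw [Finset.sum_eq_single (S.mode n ω)]
    · simp [Set.indicator, Strategy.stepCost]
    · intro i _ hi
      simp [Set.indicator, hi.symm]
    · simp
  rw [show S.stepCost g X n = _ from funext hpair]
  refine integrable_finsetSum _ fun i _ => Integrable.indicator (Integrable.indicator ?_ ?_) ?_
  · exact integrable_mode_comp (u := fun j t ω => g i j t (X t ω)) (hc i)
      (S.measurable_mode (n + 1)) (S.measurable_time (n + 1))
  · exact measurableSet_lt_horizon (S.measurable_time (n + 1))
  · exact S.measurable_mode n (measurableSet_singleton i)

theorem expectedCost_eq (H : IsSwitchingSystem P F ψ g X Y) (S : Strategy F i₀) :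
    S.expectedCost P g X = ∑' n, ENNReal.ofReal (∫ ω, S.stepCost g X n ω ∂P) := by
  simp_rw [ofReal_integral_eq_lintegral_ofReal (H.integrable_stepCost S _)
    (ae_of_all _ fun ω => H.stepCost_nonneg S _ ω)]
  rw [← lintegral_tsum fun n =>
    (H.integrable_stepCost S n).aestronglyMeasurable.aemeasurable.ennreal_ofReal]
  simp only [Strategy.expectedCost, Strategy.stepCost]
  congr 1
  ext ω
  congr 1
  ext n
  split_ifs <;> simp

theorem ae_tendsto_stepCost (H : IsSwitchingSystem P F ψ g X Y) (S : Strategy F i₀)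
    (hS : S.expectedCost P g X ≠ ∞) :
    ∀ᵐ ω ∂P, Tendsto (fun n => S.stepCost g X n ω) atTop (𝓝 0) := by
  rw [H.expectedCost_eq] at hS
  simp_rw [ofReal_integral_eq_lintegral_ofReal (H.integrable_stepCost S _)
    (ae_of_all _ fun ω => H.stepCost_nonneg S _ ω)] at hS
  have hm := fun n => (H.integrable_stepCost S n).aestronglyMeasurable.aemeasurable.ennreal_ofReal
  rw [← lintegral_tsum hm] at hS
  filter_upwards [ae_lt_top' (AEMeasurable.tsum hm) hS] with ω hω
  refine ((ENNReal.tendsto_toReal ENNReal.zero_ne_top).comp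
    (ENNReal.tendsto_atTop_zero_of_tsum_ne_top hω.ne)).congr fun n => ?_
  simp [ENNReal.toReal_ofReal (H.stepCost_nonneg S n ω)]

/-- A strategy of finite expected cost almost surely reaches the horizon or stops changing
mode. -/
theorem ae_eventually_stationary (H : IsSwitchingSystem P F ψ g X Y) (S : Strategy F i₀)
    (hS : S.expectedCost P g X ≠ ∞) :
    ∀ᵐ ω ∂P, (∃ n, (S.time n ω : ℝ) = T) ∨ ∃ i, ∀ᶠ n in atTop, S.mode n ω = i := by
  filter_upwards [H.ae_tendsto_stepCost S hS] with ω hω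
  refine or_iff_not_imp_left.2 fun hT => ?_
  have hlt : ∀ n, (S.time n ω : ℝ) < T := fun n =>
    lt_of_le_of_ne (S.time n ω).2.2 fun h => hT ⟨n, h⟩
  have hmono : Monotone fun n => (S.time (n + 1) ω : ℝ) := fun a b hab =>
    Subtype.coe_le_coe.2 (S.monotone_time ω (Nat.succ_le_succ hab))
  have hlim := tendsto_atTop_ciSup hmono ⟨T, by rintro _ ⟨n, rfl⟩; exact (hlt _).le⟩
  set x : ℝ := ⨆ n, (S.time (n + 1) ω : ℝ)
  have hx : x ∈ Set.Icc 0 T := isClosed_Icc.mem_of_tendsto hlim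
    (Eventually.of_forall fun n => (S.time (n + 1) ω).2)
  have hlim' : Tendsto (fun n => S.time (n + 1) ω) atTop (𝓝 (⟨x, hx⟩ : TimeSet T)) :=
    tendsto_subtype_rng.2 hlim
  obtain ⟨α, hα, hloop⟩ := H.coeff.cost_loop
  refine exists_eventually_eq_of_tendsto_cost
    (G := fun i j (t : TimeSet T) => g i j t (X t ω)) (x := ⟨x, hx⟩)
    (fun i j => ((H.cost i j).continuous ω).continuousAt) (fun i => H.coeff.cost_self _ _ _)
    (fun i j l => H.coeff.cost_triangle i j l _ _)
    (fun i j hij => hα.trans (hloop i j _ _ hij)) hlim' ?_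
  refine hω.congr fun n => ?_
  simp [Strategy.stepCost, hlt]

/-- For strategies of finite expected cost the mean profits of the truncated strategies
converge. -/
theorem tendsto_integral_truncGain (H : IsSwitchingSystem P F ψ g X Y) (S : Strategy F i₀)
    (hS : S.expectedCost P g X ≠ ∞) :
    Tendsto (fun n => ∫ ω, S.truncGain ψ X n ω ∂P) atTop
      (𝓝 (∫ ω, (∫ s, ψ (S.currentMode s ω) s (X s ω)) ∂P)) := by
  obtain ⟨W, hW, hb⟩ := H.exists_truncGain_bound (i₀ := i₀)
  refine tendsto_integral_of_dominated_convergence W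
    (fun n => (H.measurable_truncGain S n).aestronglyMeasurable) hW
    (fun n => ae_of_all _ fun ω => hb S n ω) ?_
  filter_upwards [H.ae_eventually_stationary S hS] with ω hω
  refine tendsto_integral_of_dominated_convergence (fun s => ∑ i, |ψ i s (X s ω)|)
    (fun n => (H.measurable_truncRate S n ω).aestronglyMeasurable) (H.integrable_sum_abs_profit ω)
    (fun n => ae_of_all _ fun s => S.abs_truncRate_le n ω s) (ae_of_all _ fun s => ?_)
  exact tendsto_const_nhds.congr' ((S.eventually_truncRate_eq hω).mono fun n hn => hn.symm)

theorem tendsto_sum_integral_stepCost (H : IsSwitchingSystem P F ψ g X Y) (S : Strategy F i₀)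
    (hS : S.expectedCost P g X ≠ ∞) :
    Tendsto (fun n => ∑ l ∈ Finset.range n, ∫ ω, S.stepCost g X l ω ∂P) atTop
      (𝓝 (S.expectedCost P g X).toReal) := by
  rw [H.expectedCost_eq] at hS ⊢
  have h := (ENNReal.hasSum_toReal hS).tendsto_sum_nat
  rw [← ENNReal.tsum_toReal_eq (ENNReal.ne_top_of_tsum_ne_top hS)] at h
  refine h.congr fun n => Finset.sum_congr rfl fun l _ => ?_
  exact ENNReal.toReal_ofReal (integral_nonneg fun ω => H.stepCost_nonneg S l ω)

/-! ### The value along a strategy -/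

theorem isDominated_total (H : IsSwitchingSystem P F ψ g X Y) (i : Fin m) :
    IsDominated P fun t ω => Y i t ω + negTail ψ X i t ω :=
  (H.isEnvelope i).total

theorem integral_mode_total_le (H : IsSwitchingSystem P F ψ g X Y) (S : Strategy F i₀) (n : ℕ)
    {τ : Ω → TimeSet T} (hτ : IsStop F τ) (hle : ∀ ω, S.time n ω ≤ τ ω) :
    ∫ ω, (Y (S.mode n ω) (τ ω) ω + negTail ψ X (S.mode n ω) (τ ω) ω) ∂P ≤
      ∫ ω, (Y (S.mode n ω) (S.time n ω) ω + negTail ψ X (S.mode n ω) (S.time n ω) ω) ∂P := by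
  refine ((integral_mode_comp H.isDominated_total (S.measurable_mode n) hτ.measurable).trans_le
    (Finset.sum_le_sum fun i _ => ?_)).trans (integral_mode_comp H.isDominated_total
      (S.measurable_mode n) (S.measurable_time n)).ge
  exact (H.isEnvelope i).setIntegral_total_le H.horizon_pos (S.isStop n) hτ hle
    (S.mode_measurable n (measurableSet_singleton i))

/-- A first hitting strategy does not meet the obstacle of the current mode between two switches. -/
theorem integral_mode_total_eq (H : IsSwitchingSystem P F ψ g X Y) (S : Strategy F i₀)
    (hS : S.IsFirstHitting g X Y) (n : ℕ) :
    ∫ ω, (Y (S.mode n ω) (S.time (n + 1) ω) ω +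
        negTail ψ X (S.mode n ω) (S.time (n + 1) ω) ω) ∂P =
      ∫ ω, (Y (S.mode n ω) (S.time n ω) ω + negTail ψ X (S.mode n ω) (S.time n ω) ω) ∂P := by
  refine ((integral_mode_comp H.isDominated_total (S.measurable_mode n)
    (S.measurable_time (n + 1))).trans (Finset.sum_congr rfl fun i _ => ?_)).trans
      (integral_mode_comp H.isDominated_total (S.measurable_mode n) (S.measurable_time n)).symm
  refine (H.isEnvelope i).setIntegral_total_eq H.horizon_pos (S.isStop n) (S.isStop (n + 1))
    (S.time_le_succ n) (S.mode_measurable n (measurableSet_singleton i)) fun ω hω t h1 h2 h3 => ?_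
  have hω : S.mode n ω = i := hω
  exact absurd ((hS.time_isGLB n ω).1 ⟨h1, by rw [hω]; exact h3⟩) (not_le.2 h2)

/-- Switching never increases the value net of the switching cost. -/
theorem ae_value_switch_le (H : IsSwitchingSystem P F ψ g X Y) (S : Strategy F i₀) (n : ℕ) :
    ∀ᵐ ω ∂P, Y (S.mode (n + 1) ω) (S.time (n + 1) ω) ω - S.stepCost g X n ω ≤
      Y (S.mode n ω) (S.time (n + 1) ω) ω := by
  filter_upwards [H.terminal, ae_all_iff.2 H.obstacle_le] with ω hT hob
  unfold Strategy.stepCost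
  split_ifs with ht
  · by_cases hne : S.mode (n + 1) ω = S.mode n ω
    · rw [hne, H.coeff.cost_self, sub_zero]
    · refine le_trans ?_ (hob (S.mode n ω) (S.time (n + 1) ω))
      have := le_ciSup (f := fun j : {j // j ≠ S.mode n ω} =>
        -g (S.mode n ω) j (S.time (n + 1) ω) (X (S.time (n + 1) ω) ω) +
          Y j (S.time (n + 1) ω) ω) (Set.finite_range _).bddAbove ⟨S.mode (n + 1) ω, hne⟩
      refine le_trans (le_of_eq ?_) this
      ring
  · have ht' := le_antisymm (S.time (n + 1) ω).2.2 (not_lt.1 ht)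
    rw [hT _ _ ht', hT _ _ ht', sub_zero]

omit [IsProbabilityMeasure P] in
/-- Before the horizon, the first hitting time of the obstacle is a point of contact. -/
theorem value_eq_obstacle_of_lt (hY : ∀ i ω, Continuous fun t => Y i t ω)
    (hob : ∀ i ω, Continuous fun t => obstacle g X Y i t ω) {S : Strategy F i₀}
    (hS : S.IsFirstHitting g X Y) (n : ℕ) (ω : Ω) (ht : (S.time (n + 1) ω : ℝ) < T) :
    Y (S.mode n ω) (S.time (n + 1) ω) ω = obstacle g X Y (S.mode n ω) (S.time (n + 1) ω) ω := by
  have hglb := hS.time_isGLB n ω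
  have hcl : IsClosed {s : TimeSet T | S.time n ω ≤ s ∧
      Y (S.mode n ω) s ω = obstacle g X Y (S.mode n ω) s ω} :=
    isClosed_Ici.inter (isClosed_eq (hY _ ω) (hob _ ω))
  rcases Set.eq_empty_or_nonempty {s : TimeSet T | S.time n ω ≤ s ∧
      Y (S.mode n ω) s ω = obstacle g X Y (S.mode n ω) s ω} with he | hne
  · rw [he] at hglb
    have hmem : (0 : ℝ) ≤ T := (S.time n ω).2.1.trans (S.time n ω).2.2
    have h1 : (⟨T, hmem, le_rfl⟩ : TimeSet T) ≤ S.time (n + 1) ω := hglb.2 (by simp)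
    exact absurd (Subtype.coe_le_coe.2 h1) (not_le.2 ht)
  · exact (hglb.mem_of_isClosed hne hcl).2

theorem ae_value_switch_eq (H : IsSwitchingSystem P F ψ g X Y) (S : Strategy F i₀)
    (hS : S.IsFirstHitting g X Y) (n : ℕ) :
    ∀ᵐ ω ∂P, Y (S.mode (n + 1) ω) (S.time (n + 1) ω) ω - S.stepCost g X n ω =
      Y (S.mode n ω) (S.time (n + 1) ω) ω := by
  filter_upwards [H.terminal] with ω hT
  unfold Strategy.stepCost
  split_ifs with ht
  · rw [value_eq_obstacle_of_lt (fun i => (H.value i).continuous)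
      (fun i => (H.isDominated_obstacle i).continuous) hS n ω ht, ← hS.mode_argmax n ω]
    ring
  · have ht' := le_antisymm (S.time (n + 1) ω).2.2 (not_lt.1 ht)
    rw [hT _ _ ht', hT _ _ ht', sub_zero]

theorem meanValue_zero (H : IsSwitchingSystem P F ψ g X Y) (S : Strategy F i₀) :
    S.meanValue P ψ g X Y 0 = ∫ ω, Y i₀ ⟨0, le_rfl, H.horizon_pos.le⟩ ω ∂P := by
  unfold Strategy.meanValue
  rw [Finset.range_zero, Finset.sum_empty, sub_zero, ← integral_add (H.integrable_truncGain S 0)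
    (integrable_mode_comp H.isDominated_total (S.measurable_mode 0) (S.measurable_time 0))]
  congr 1
  ext ω
  have h0 : S.time 0 ω = ⟨0, le_rfl, H.horizon_pos.le⟩ := Subtype.ext (S.time_zero ω)
  rw [truncGain_zero, S.mode_zero, h0]
  ring

theorem meanValue_succ (H : IsSwitchingSystem P F ψ g X Y) (S : Strategy F i₀) (n : ℕ) :
    S.meanValue P ψ g X Y (n + 1) = S.meanValue P ψ g X Y n +
      (∫ ω, (Y (S.mode n ω) (S.time (n + 1) ω) ω +
          negTail ψ X (S.mode n ω) (S.time (n + 1) ω) ω) ∂P -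
        ∫ ω, (Y (S.mode n ω) (S.time n ω) ω + negTail ψ X (S.mode n ω) (S.time n ω) ω) ∂P) +
      (∫ ω, (Y (S.mode (n + 1) ω) (S.time (n + 1) ω) ω - S.stepCost g X n ω) ∂P -
        ∫ ω, Y (S.mode n ω) (S.time (n + 1) ω) ω ∂P) := by
  have hY := fun i => (H.value i).isDominated
  have hN := H.isDominated_negTail
  have hm := S.measurable_mode
  have ht := S.measurable_time
  have h1 := integrable_mode_comp hY (hm n) (ht (n + 1))
  have h2 := integrable_mode_comp hN (hm n) (ht (n + 1))
  have h3 := integrable_mode_comp hY (hm (n + 1)) (ht (n + 1))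
  have h4 := integrable_mode_comp hN (hm (n + 1)) (ht (n + 1))
  have hgain : ∫ ω, S.truncGain ψ X (n + 1) ω ∂P = ∫ ω, S.truncGain ψ X n ω ∂P +
      ∫ ω, negTail ψ X (S.mode n ω) (S.time (n + 1) ω) ω ∂P -
        ∫ ω, negTail ψ X (S.mode (n + 1) ω) (S.time (n + 1) ω) ω ∂P := by
    simp_rw [H.truncGain_succ S n]
    have h5 := integral_sub ((H.integrable_truncGain S n).add h2) h4
    have h6 := integral_add (H.integrable_truncGain S n) h2
    simp only [Pi.add_apply] at h5
    rw [h5, h6]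
  unfold Strategy.meanValue
  rw [hgain, Finset.sum_range_succ, integral_sub h3 (H.integrable_stepCost S n),
    integral_add h3 h4, integral_add h1 h2]
  ring

theorem meanValue_le (H : IsSwitchingSystem P F ψ g X Y) (S : Strategy F i₀) (n : ℕ) :
    S.meanValue P ψ g X Y n ≤ ∫ ω, Y i₀ ⟨0, le_rfl, H.horizon_pos.le⟩ ω ∂P := by
  induction n with
  | zero => exact (H.meanValue_zero S).le
  | succ n ih =>
    have hY := fun i => (H.value i).isDominated
    have h1 := H.integral_mode_total_le S n (S.isStop (n + 1)) (S.time_le_succ n)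
    have h2 := integral_mono_ae
      ((integrable_mode_comp hY (S.measurable_mode (n + 1)) (S.measurable_time (n + 1))).sub
        (H.integrable_stepCost S n))
      (integrable_mode_comp hY (S.measurable_mode n) (S.measurable_time (n + 1)))
      (H.ae_value_switch_le S n)
    simp only [Pi.sub_apply] at h2
    rw [H.meanValue_succ S n]
    linarith

theorem meanValue_eq (H : IsSwitchingSystem P F ψ g X Y) (S : Strategy F i₀)
    (hS : S.IsFirstHitting g X Y) (n : ℕ) :
    S.meanValue P ψ g X Y n = ∫ ω, Y i₀ ⟨0, le_rfl, H.horizon_pos.le⟩ ω ∂P := by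
  induction n with
  | zero => exact H.meanValue_zero S
  | succ n ih =>
    rw [H.meanValue_succ S n, H.integral_mode_total_eq S hS n,
      integral_congr_ae (H.ae_value_switch_eq S hS n), ih]
    ring

/-- No strategy earns more than the initial value. -/
theorem profit_le (H : IsSwitchingSystem P F ψ g X Y) (S : Strategy F i₀) :
    S.profit P ψ g X ≤ ((∫ ω, Y i₀ ⟨0, le_rfl, H.horizon_pos.le⟩ ω ∂P : ℝ) : EReal) := by
  by_cases hS : S.expectedCost P g X = ∞
  · simp [Strategy.profit, hS]
  -- Keeping the last mode until the horizon is not better than the value.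
  have htail : ∀ n, 0 ≤ ∫ ω, (Y (S.mode n ω) (S.time n ω) ω +
      negTail ψ X (S.mode n ω) (S.time n ω) ω) ∂P := fun n => by
    refine le_trans (le_of_eq ?_) (H.integral_mode_total_le S n
      (isStop_const ⟨T, H.horizon_pos.le, le_rfl⟩) fun ω => (S.time n ω).2.2)
    refine (integral_eq_zero_of_ae ?_).symm
    filter_upwards [H.terminal] with ω hω
    rw [hω _ _ rfl, negTail, setIntegral_Ioi_of_eq_horizon _ rfl]
    simp
  have hle := le_of_tendsto' ((H.tendsto_integral_truncGain S hS).sub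
    (H.tendsto_sum_integral_stepCost S hS)) fun n => by
      have h1 := H.meanValue_le S n
      have h2 := htail n
      unfold Strategy.meanValue at h1
      show _ ≤ ∫ ω, Y i₀ ⟨0, le_rfl, H.horizon_pos.le⟩ ω ∂P
      linarith
  rw [Strategy.profit, ← EReal.coe_ennreal_toReal hS, ← EReal.coe_sub]
  exact EReal.coe_le_coe hle

/-- The mean value is constant along a first hitting strategy, so the mean costs of its first `n`
switches are bounded in `n`. -/
theorem expectedCost_ne_top (H : IsSwitchingSystem P F ψ g X Y) (S : Strategy F i₀)
    (hS : S.IsFirstHitting g X Y) : S.expectedCost P g X ≠ ∞ := by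
  obtain ⟨W, hW, hb⟩ := H.exists_truncGain_bound (i₀ := i₀)
  obtain ⟨W', hW', hb'⟩ := exists_bound_family H.isDominated_total
  set C : ℝ := ∫ ω, W ω ∂P + ∫ ω, W' ω ∂P - ∫ ω, Y i₀ ⟨0, le_rfl, H.horizon_pos.le⟩ ω ∂P
  have hsum : ∀ n, ∑ l ∈ Finset.range n, ∫ ω, S.stepCost g X l ω ∂P ≤ C := fun n => by
    have h1 := H.meanValue_eq S hS n
    have h2 : ∫ ω, S.truncGain ψ X n ω ∂P ≤ ∫ ω, W ω ∂P :=
      integral_mono (H.integrable_truncGain S n) hW fun ω => (abs_le.1 (hb S n ω)).2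
    have h3 : ∫ ω, (Y (S.mode n ω) (S.time n ω) ω +
        negTail ψ X (S.mode n ω) (S.time n ω) ω) ∂P ≤ ∫ ω, W' ω ∂P :=
      integral_mono_ae (integrable_mode_comp H.isDominated_total (S.measurable_mode n)
        (S.measurable_time n)) hW' (hb'.mono fun ω h => (abs_le.1 (h _ _)).2)
    unfold Strategy.meanValue at h1
    simp only [C]
    linarith
  rw [H.expectedCost_eq]
  refine ne_top_of_le_ne_top (b := ENNReal.ofReal C) ENNReal.ofReal_ne_top
    (ENNReal.tsum_le_of_sum_range_le fun n => ?_)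
  rw [← ENNReal.ofReal_sum_of_nonneg fun l _ => integral_nonneg fun ω => H.stepCost_nonneg S l ω]
  exact ENNReal.ofReal_le_ofReal (hsum n)

/-- A first hitting strategy changes mode at every step, so its modes are never stationary. -/
theorem isFinite (H : IsSwitchingSystem P F ψ g X Y) (S : Strategy F i₀)
    (hS : S.IsFirstHitting g X Y) : S.IsFinite P := by
  filter_upwards [H.ae_eventually_stationary S (H.expectedCost_ne_top S hS)] with ω hω
  refine hω.resolve_right ?_
  rintro ⟨i, hi⟩
  obtain ⟨n, hn⟩ := (hi.and ((tendsto_add_atTop_nat 1).eventually hi)).exists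
  exact hS.mode_ne n ω (hn.2.trans hn.1.symm)

/-- The first hitting strategies earn the initial value. -/
theorem profit_eq (H : IsSwitchingSystem P F ψ g X Y) (S : Strategy F i₀)
    (hS : S.IsFirstHitting g X Y) :
    S.profit P ψ g X = ((∫ ω, Y i₀ ⟨0, le_rfl, H.horizon_pos.le⟩ ω ∂P : ℝ) : EReal) := by
  have hfin := H.expectedCost_ne_top S hS
  obtain ⟨W, hW, hb⟩ := exists_bound_family H.isDominated_total
  have htail : Tendsto (fun n => ∫ ω, (Y (S.mode n ω) (S.time n ω) ω +
      negTail ψ X (S.mode n ω) (S.time n ω) ω) ∂P) atTop (𝓝 (∫ _, (0 : ℝ) ∂P)) := by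
    refine tendsto_integral_of_dominated_convergence W (fun n =>
      (measurable_mode_comp H.isDominated_total (S.measurable_mode n)
        (S.measurable_time n)).aestronglyMeasurable) hW
      (fun n => hb.mono fun ω h => h _ _) ?_
    filter_upwards [H.isFinite S hS, H.terminal] with ω ⟨N, hN⟩ hT
    refine tendsto_const_nhds.congr' ?_
    filter_upwards [eventually_ge_atTop N] with n hn
    have ht : (S.time n ω : ℝ) = T := le_antisymm (S.time n ω).2.2
      (hN.ge.trans (Subtype.coe_le_coe.2 (S.monotone_time ω hn)))
    rw [hT _ _ ht, negTail, setIntegral_Ioi_of_eq_horizon _ ht]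
    simp
  have hlim := ((H.tendsto_integral_truncGain S hfin).sub
    (H.tendsto_sum_integral_stepCost S hfin)).add htail
  rw [integral_zero, add_zero] at hlim
  have heq := tendsto_nhds_unique hlim
    (tendsto_const_nhds.congr fun n => (H.meanValue_eq S hS n).symm)
  rw [Strategy.profit, ← EReal.coe_ennreal_toReal hfin, ← EReal.coe_sub, heq]

end IsSwitchingSystem

end OptimalSwitching

namespace OptimalSwitching

variable {Ω : Type*} [mΩ : MeasurableSpace Ω] {T : ℝ} {F : Filtration (TimeSet T) mΩ} {m k : ℕ}

/-! ### Existence of first hitting strategies -/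

theorem exists_isGLB (hT : 0 ≤ T) (s : Set (TimeSet T)) : ∃ t, IsGLB s t :=
  have : Fact (0 ≤ T) := ⟨hT⟩
  ⟨sInf s, isGLB_sInf s⟩

/-- A continuous function vanishes somewhere between `a` and `t` if and only if it takes
arbitrarily small values there, and for this the countably many points `t` and those of a dense
sequence suffice. -/
theorem exists_zero_iff_forall_small {f : TimeSet T → ℝ} (hf : Continuous f) {a t : TimeSet T}
    {d : ℕ → TimeSet T} (hd : DenseRange d) :
    (∃ s, a ≤ s ∧ s ≤ t ∧ f s = 0) ↔
      ∀ n : ℕ, ∃ r ∈ insert t (Set.range d ∩ Set.Iic t), a ≤ r ∧ |f r| < 1 / ((n : ℝ) + 1) := by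
  constructor
  · rintro ⟨s, has, hst, hs⟩ n
    have hn : (0 : ℝ) < 1 / ((n : ℝ) + 1) := Nat.one_div_pos_of_nat
    rcases hst.eq_or_lt with rfl | hst
    · exact ⟨s, Set.mem_insert _ _, has, by simpa [hs] using hn⟩
    · have hev : ∀ᶠ r in 𝓝[>] s, |f r| < 1 / ((n : ℝ) + 1) :=
        nhdsWithin_le_nhds ((hf.abs.tendsto s).eventually (gt_mem_nhds (by simpa [hs] using hn)))
      have hne : (𝓝[>] s).NeBot := nhdsGT_neBot_of_exists_gt ⟨t, hst⟩
      obtain ⟨r, hr1, hr2⟩ := (hev.and (Ioo_mem_nhdsGT hst)).exists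
      obtain ⟨l, hl1, hl2⟩ := hd.exists_mem_open
        ((isOpen_lt hf.abs continuous_const).inter isOpen_Ioo) ⟨r, hr1, hr2⟩
      exact ⟨d l, Set.mem_insert_of_mem _ ⟨⟨l, rfl⟩, hl2.2.le⟩, has.trans hl2.1.le, hl1⟩
  · intro h
    have hmem : ∀ r ∈ insert t (Set.range d ∩ Set.Iic t), r ≤ t := by
      rintro r (rfl | hr)
      · exact le_rfl
      · exact hr.2
    obtain ⟨r, hr, har, -⟩ := h 0
    obtain ⟨s, hs, hmin⟩ := isClosed_Icc.isCompact.exists_isMinOn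
      (Set.nonempty_Icc.2 (har.trans (hmem r hr))) hf.abs.continuousOn
    refine ⟨s, hs.1, hs.2, abs_nonpos_iff.1 ?_⟩
    refine ge_of_tendsto' tendsto_one_div_add_atTop_nhds_zero_nat fun n => ?_
    obtain ⟨r, hr, har, hlt⟩ := h n
    exact (hmin (show r ∈ Set.Icc a t from ⟨har, hmem r hr⟩)).trans hlt.le

/-- The first zero after a stopping time of a continuous adapted process, chosen among finitely
many at that stopping time, is a stopping time. -/
theorem IsStop.exists_hitting (hT : 0 ≤ T) {q : Fin m → TimeSet T → Ω → ℝ}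
    (hqc : ∀ i ω, Continuous fun t => q i t ω) (hqm : ∀ i t, Measurable[F t] (q i t))
    {σ : Ω → TimeSet T} (hσ : IsStop F σ) {κ : Ω → Fin m}
    (hκ : Measurable[IsStoppingTime.measurableSpace hσ] κ) :
    ∃ D : Ω → TimeSet T, IsStop F D ∧
      ∀ ω, IsGLB {s | σ ω ≤ s ∧ q (κ ω) s ω = 0} (D ω) := by
  have hne : Nonempty (TimeSet T) := ⟨⟨T, hT, le_rfl⟩⟩
  choose D hD using fun ω => exists_isGLB hT {s | σ ω ≤ s ∧ q (κ ω) s ω = 0}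
  refine ⟨D, isStop_iff.2 fun t => ?_, hD⟩
  rcases eq_or_lt_of_le t.2.2 with ht | ht
  · convert MeasurableSet.univ
    ext ω
    simpa using Subtype.coe_le_coe.1 ((D ω).2.2.trans ht.ge)
  have hiff : ∀ ω, D ω ≤ t ↔ ∃ s, σ ω ≤ s ∧ s ≤ t ∧ q (κ ω) s ω = 0 := fun ω => by
    refine ⟨fun h => ?_, fun ⟨s, h1, h2, h3⟩ => ((hD ω).1 ⟨h1, h3⟩).trans h2⟩
    have hcl : IsClosed {s | σ ω ≤ s ∧ q (κ ω) s ω = 0} :=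
      isClosed_Ici.inter (isClosed_eq (hqc _ ω) continuous_const)
    rcases Set.eq_empty_or_nonempty {s | σ ω ≤ s ∧ q (κ ω) s ω = 0} with he | hne
    · have hglb := hD ω
      rw [he] at hglb
      have h1 : (⟨T, hT, le_rfl⟩ : TimeSet T) ≤ D ω := hglb.2 (by simp)
      exact absurd (Subtype.coe_le_coe.2 (h1.trans h)) (not_le.2 ht)
    · have hmem := (hD ω).mem_of_isClosed hne hcl
      exact ⟨D ω, hmem.1, h, hmem.2⟩
  have hset : {ω | D ω ≤ t} = ⋃ i, ⋂ n : ℕ,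
      ⋃ r ∈ insert t (Set.range (TopologicalSpace.denseSeq (TimeSet T)) ∩ Set.Iic t),
        (κ ⁻¹' {i} ∩ {ω | σ ω ≤ r}) ∩ {ω | |q i r ω| < 1 / ((n : ℝ) + 1)} := by
    ext ω
    rw [Set.mem_ofPred_eq, hiff, exists_zero_iff_forall_small (hqc _ ω)
      (TopologicalSpace.denseRange_denseSeq (TimeSet T))]
    simp only [Set.mem_iUnion, Set.mem_iInter, Set.mem_inter_iff, Set.mem_preimage,
      Set.mem_singleton_iff, Set.mem_ofPred_eq, exists_prop]
    constructor
    · intro h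
      refine ⟨κ ω, fun n => ?_⟩
      obtain ⟨r, hr, h1, h2⟩ := h n
      exact ⟨r, hr, ⟨rfl, h1⟩, h2⟩
    · rintro ⟨i, h⟩ n
      obtain ⟨r, hr, ⟨rfl, h1⟩, h2⟩ := h n
      exact ⟨r, hr, h1, h2⟩
  rw [hset]
  refine MeasurableSet.iUnion fun i => MeasurableSet.iInter fun n => MeasurableSet.biUnion
    (((Set.countable_range _).mono Set.inter_subset_left).insert t) fun r hr => ?_
  have hrt : r ≤ t := by
    rcases hr with rfl | hr
    · exact le_rfl
    · exact hr.2
  have h1 := hσ.measurableSet_inter_le (hκ (measurableSet_singleton i)) r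
  have h2 : MeasurableSet[F r] {ω | |q i r ω| < 1 / ((n : ℝ) + 1)} :=
    (measurable_norm.comp (hqm i r)) measurableSet_Iio
  exact F.mono hrt _ (h1.inter h2)

theorem IsStop.measurable_comp (hT : 0 ≤ T) {u : TimeSet T → Ω → ℝ}
    (huc : ∀ ω, Continuous fun t => u t ω) (hum : ∀ t, Measurable[F t] (u t))
    {τ : Ω → TimeSet T} (hτ : IsStop F τ) :
    Measurable[IsStoppingTime.measurableSpace hτ] fun ω => u (τ ω) ω := by
  have hne : Nonempty (TimeSet T) := ⟨⟨T, hT, le_rfl⟩⟩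
  have hadapted : StronglyAdapted F u := fun t => (hum t).stronglyMeasurable
  exact measurable_stoppedValue (hadapted.isStronglyProgressive_of_continuous huc) hτ

/-- Measurable selection from finitely many alternatives. -/
theorem exists_measurable_selection {α : Type*} [MeasurableSpace α] {Q : Fin m → α → Prop}
    (hQ : ∀ j, MeasurableSet {a | Q j a}) (hex : ∀ a, ∃ j, Q j a) :
    ∃ κ : α → Fin m, Measurable κ ∧ ∀ a, Q (κ a) a := by
  classical
  let p : ℕ → α → Prop := fun n a => ∃ h : n < m, Q ⟨n, h⟩ a
  have hp : ∀ a, ∃ n, p n a := fun a =>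
    let ⟨j, hj⟩ := hex a
    ⟨j, j.2, hj⟩
  have hpm : ∀ n, MeasurableSet {a | p n a} := fun n => by
    by_cases h : n < m
    · simpa [p, h] using hQ ⟨n, h⟩
    · simp [p, h]
  have hfind : Measurable fun a => Nat.find (hp a) := measurable_find hp hpm
  refine ⟨fun a => ⟨Nat.find (hp a), (Nat.find_spec (hp a)).1⟩, ?_, fun a =>
    (Nat.find_spec (hp a)).2⟩
  refine measurable_to_countable' fun j => ?_
  convert hfind (measurableSet_singleton (j : ℕ)) using 1
  ext a
  simp [Fin.ext_iff]

namespace IsSwitchingSystem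

variable {P : Measure Ω} [IsProbabilityMeasure P] {i₀ : Fin m}
  {ψ : Fin m → TimeSet T → EuclideanSpace ℝ (Fin k) → ℝ}
  {g : Fin m → Fin m → TimeSet T → EuclideanSpace ℝ (Fin k) → ℝ}
  {X : TimeSet T → Ω → EuclideanSpace ℝ (Fin k)} {Y : Fin m → TimeSet T → Ω → ℝ}

/-- The passage from one switch to the next one in a first hitting strategy. -/
theorem exists_next_switch (H : IsSwitchingSystem P F ψ g X Y) {σ : Ω → TimeSet T}
    (hσ : IsStop F σ) {κ : Ω → Fin m} (hκ : Measurable[IsStoppingTime.measurableSpace hσ] κ) :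
    ∃ (D : Ω → TimeSet T) (hD : IsStop F D) (ξ : Ω → Fin m),
      Measurable[IsStoppingTime.measurableSpace hD] ξ ∧
      (∀ ω, IsGLB {s | σ ω ≤ s ∧ Y (κ ω) s ω = obstacle g X Y (κ ω) s ω} (D ω)) ∧
      (∀ ω, ξ ω ≠ κ ω) ∧
      ∀ ω, -g (κ ω) (ξ ω) (D ω) (X (D ω) ω) + Y (ξ ω) (D ω) ω =
        obstacle g X Y (κ ω) (D ω) ω := by
  have hT := H.horizon_pos.le
  have hYm := fun i => measurable_of_isProgressive (H.value i).progressive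
  have hgm := fun i j => measurable_of_isProgressive (H.cost i j).progressive
  have hYc := fun i => (H.value i).continuous
  have hgc := fun i j => (H.cost i j).continuous
  have hoc := fun i => (H.isDominated_obstacle i).continuous
  obtain ⟨D, hD, hglb⟩ := hσ.exists_hitting hT
    (q := fun i t ω => Y i t ω - obstacle g X Y i t ω) (fun i ω => (hYc i ω).sub (hoc i ω))
    (fun i t => (hYm i t).sub (H.measurable_obstacle i t)) hκ
  simp only [sub_eq_zero] at hglb
  have hσD : ∀ ω, σ ω ≤ D ω := fun ω => (hglb ω).2 fun s hs => hs.1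
  have hκD : Measurable[IsStoppingTime.measurableSpace hD] κ :=
    hκ.mono (IsStoppingTime.measurableSpace_mono hσ hD fun ω =>
      WithTop.coe_le_coe.2 (hσD ω)) le_rfl
  have hQ : ∀ j, MeasurableSet[IsStoppingTime.measurableSpace hD] {ω | j ≠ κ ω ∧
      -g (κ ω) j (D ω) (X (D ω) ω) + Y j (D ω) ω = obstacle g X Y (κ ω) (D ω) ω} := fun j => by
    have hset : {ω | j ≠ κ ω ∧ -g (κ ω) j (D ω) (X (D ω) ω) + Y j (D ω) ω =
        obstacle g X Y (κ ω) (D ω) ω} = ⋃ i : {i // j ≠ i}, κ ⁻¹' {i.1} ∩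
          {ω | -g i j (D ω) (X (D ω) ω) + Y j (D ω) ω = obstacle g X Y i (D ω) ω} := by
      ext ω
      simp only [Set.mem_ofPred_eq, Set.mem_iUnion, Set.mem_inter_iff, Set.mem_preimage,
        Set.mem_singleton_iff]
      constructor
      · rintro ⟨h1, h2⟩
        exact ⟨⟨κ ω, h1⟩, rfl, h2⟩
      · rintro ⟨⟨i, h1⟩, rfl, h2⟩
        exact ⟨h1, h2⟩
    rw [hset]
    refine MeasurableSet.iUnion fun i => (hκD (measurableSet_singleton i.1)).inter ?_
    exact measurableSet_eq_fun
      ((hD.measurable_comp hT (hgc i j) (hgm i j)).neg.add (hD.measurable_comp hT (hYc j) (hYm j)))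
      (hD.measurable_comp hT (hoc i) (H.measurable_obstacle i))
  obtain ⟨ξ, hξ, hsel⟩ := @exists_measurable_selection m Ω
      (IsStoppingTime.measurableSpace hD) _ hQ fun ω => by
    have := H.nonempty_ne (κ ω)
    obtain ⟨j, hj⟩ := exists_eq_ciSup_of_finite (f := fun j : {j // j ≠ κ ω} =>
      -g (κ ω) j (D ω) (X (D ω) ω) + Y j (D ω) ω)
    exact ⟨j, j.2, hj⟩
  exact ⟨D, hD, ξ, hξ, hglb, fun ω => (hsel ω).1, fun ω => (hsel ω).2⟩

theorem exists_isFirstHitting (H : IsSwitchingSystem P F ψ g X Y) (i₀ : Fin m) :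
    ∃ S : Strategy F i₀, S.IsFirstHitting g X Y := by
  choose D hD ξ hξ hglb hne hmax using
    fun s : {s : (Ω → TimeSet T) × (Ω → Fin m) // ∃ h : IsStop F s.1,
        Measurable[IsStoppingTime.measurableSpace h] s.2} =>
      H.exists_next_switch s.2.choose s.2.choose_spec
  let s₀ : {s : (Ω → TimeSet T) × (Ω → Fin m) // ∃ h : IsStop F s.1,
      Measurable[IsStoppingTime.measurableSpace h] s.2} :=
    ⟨(fun _ => ⟨0, le_rfl, H.horizon_pos.le⟩, fun _ => i₀), isStop_const _, measurable_const⟩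
  let st := fun n : ℕ => Nat.rec (motive := fun _ => {s : (Ω → TimeSet T) × (Ω → Fin m) //
    ∃ h : IsStop F s.1, Measurable[IsStoppingTime.measurableSpace h] s.2}) s₀
      (fun _ s => ⟨(D s, ξ s), hD s, hξ s⟩) n
  exact ⟨{
    time := fun n => (st n).1.1
    mode := fun n => (st n).1.2
    time_zero := fun ω => rfl
    mode_zero := fun ω => rfl
    time_le_succ := fun n ω => (hglb (st n) ω).2 fun s hs => hs.1
    isStop := fun n => (st n).2.choose
    mode_measurable := fun n => (st n).2.choose_spec },
    ⟨fun n => hglb (st n), fun n => hne (st n), fun n => hmax (st n)⟩⟩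

end IsSwitchingSystem

/-! ### Triviality of the initial σ-algebra -/

variable {P : Measure Ω} {d : ℕ} {B : TimeSet T → Ω → (Fin d → ℝ)}

/-- The `σ`-algebra of the events of probability zero or one. -/
@[reducible]
def zeroOneSigma (P : Measure Ω) : MeasurableSpace Ω where
  MeasurableSet' A := MeasurableSet A ∧ (P A = 0 ∨ P Aᶜ = 0)
  measurableSet_empty := ⟨MeasurableSet.empty, Or.inl measure_empty⟩
  measurableSet_compl A hA := ⟨hA.1.compl, by simpa using hA.2.symm⟩
  measurableSet_iUnion s hs := by
    refine ⟨MeasurableSet.iUnion fun n => (hs n).1, ?_⟩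
    by_cases h : ∃ n, P (s n)ᶜ = 0
    · obtain ⟨n, hn⟩ := h
      exact Or.inr (measure_mono_null (Set.compl_subset_compl.2 (Set.subset_iUnion s n)) hn)
    · push Not at h
      exact Or.inl (measure_iUnion_null fun n => (hs n).2.resolve_right (h n))

/-- Since Brownian motion starts at a constant, up to null events, its completed natural
filtration is trivial at time zero. -/
theorem completedFiltration_le_zeroOneSigma (hB : IsBrownianMotion P B) {t : TimeSet T}
    (ht : (t : ℝ) = 0) : completedFiltration P B hB.measurable t ≤ zeroOneSigma P := by
  have hnat : ∀ j ≤ t, MeasurableSpace.comap (B j) inferInstance ≤ zeroOneSigma P := by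
    rintro j hj _ ⟨U, hU, rfl⟩
    have hj0 : (j : ℝ) = 0 := le_antisymm ((Subtype.coe_le_coe.2 hj).trans ht.le) j.2.1
    refine ⟨hB.measurable j hU, ?_⟩
    have h0 : P {ω | ¬B j ω = 0} = 0 := ae_iff.1 (hB.zero j hj0)
    by_cases h : (0 : Fin d → ℝ) ∈ U
    · refine Or.inr (measure_mono_null (t := {ω | ¬B j ω = 0}) (fun ω hω h' => hω ?_) h0)
      simpa [Set.mem_preimage, h'] using h
    · refine Or.inl (measure_mono_null (t := {ω | ¬B j ω = 0}) (fun ω hω h' => h ?_) h0)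
      simpa [Set.mem_preimage, h'] using hω
  have hnull : nullSigma P ≤ zeroOneSigma P :=
    MeasurableSpace.generateFrom_le fun A hA => ⟨hA.1, Or.inl hA.2⟩
  refine sup_le (iSup₂_le fun j hj => ?_) hnull
  convert hnat j hj

theorem ae_eq_integral_of_initial [IsProbabilityMeasure P] (hB : IsBrownianMotion P B)
    {t : TimeSet T} (ht : (t : ℝ) = 0) {Z : Ω → ℝ} (hZi : Integrable Z P)
    (hZ : Measurable[completedFiltration P B hB.measurable t] Z) :
    ∀ᵐ ω ∂P, Z ω = ∫ ω, Z ω ∂P := by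
  refine ae_eq_of_forall_setIntegral_eq_of_sigmaFinite'
    ((completedFiltration P B hB.measurable).le t) (fun _ _ _ => hZi.integrableOn)
    (fun _ _ _ => (integrable_const _).integrableOn) (fun A hA _ => ?_)
    hZ.stronglyMeasurable.aestronglyMeasurable
    stronglyMeasurable_const.aestronglyMeasurable
  have hAm := (completedFiltration P B hB.measurable).le t A hA
  rcases (completedFiltration_le_zeroOneSigma hB ht A hA).2 with h | h
  · simp [Measure.restrict_eq_zero.2 h]
  · have hr : P.restrict A = P := Measure.restrict_eq_self_of_ae_mem (ae_iff.2 h)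
    rw [hr]
    simp

end OptimalSwitching

open OptimalSwitching
theorem mainTheorem3
    {Ω : Type*} [mΩ : MeasurableSpace Ω] (P : Measure Ω) [IsProbabilityMeasure P]
    (T : ℝ) (hT : 0 < T) (m k d : ℕ) (hm : 2 ≤ m)
    (B : TimeSet T → Ω → (Fin d → ℝ)) (hB : IsBrownianMotion P B)
    (F : Filtration (TimeSet T) mΩ) (hF : F = completedFiltration P B hB.measurable)
    (ψ : Fin m → TimeSet T → EuclideanSpace ℝ (Fin k) → ℝ)
    (g : Fin m → Fin m → TimeSet T → EuclideanSpace ℝ (Fin k) → ℝ)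
    (hψg : CoefficientAssumptions ψ g)
    (X : TimeSet T → Ω → EuclideanSpace ℝ (Fin k))
    (hX : IsProgressive F X) (hXc : ∀ ω, Continuous fun t => X t ω)
    (hψX : ∀ i, IsM2 P F fun t ω => ψ i t (X t ω))
    (hgX : ∀ i j, IsS2 P F fun t ω => g i j t (X t ω))
    (Y : Fin m → TimeSet T → Ω → ℝ) (hY : ∀ i, IsS2 P F (Y i))
    (hsys : IsSnellSystem P F ψ g X Y)
    (i₀ : Fin m) :
    (∀ᵐ ω ∂P, (Y i₀ ⟨0, le_rfl, hT.le⟩ ω : EReal) = ⨆ S : Strategy F i₀, S.profit P ψ g X) ∧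
    (∃ S : Strategy F i₀, S.IsFirstHitting g X Y) ∧
    (∀ S : Strategy F i₀, S.IsFirstHitting g X Y →
      S.expectedCost P g X < ∞ ∧
      (∀ S' : Strategy F i₀, S'.profit P ψ g X ≤ S.profit P ψ g X) ∧
      ((S.expectedReversedCost P g X < ∞ ∨ (∀ i j, ∃ c : ℝ, ∀ t x, g i j t x = c)) →
        S.IsFinite P)) := by
  have H : IsSwitchingSystem P F ψ g X Y := ⟨hT, hm, hψg, hXc, hψX, hgX, hY, hsys⟩
  obtain ⟨S₀, hS₀⟩ := H.exists_isFirstHitting i₀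
  refine ⟨?_, ⟨S₀, hS₀⟩, fun S hS => ⟨(H.expectedCost_ne_top S hS).lt_top, fun S' => ?_,
    fun _ => H.isFinite S hS⟩⟩
  · have hsup : ⨆ S : Strategy F i₀, S.profit P ψ g X =
        ((∫ ω, Y i₀ ⟨0, le_rfl, hT.le⟩ ω ∂P : ℝ) : EReal) :=
      le_antisymm (iSup_le fun S => H.profit_le S)
        ((H.profit_eq S₀ hS₀).ge.trans (le_iSup (fun S => S.profit P ψ g X) S₀))
    subst hF
    filter_upwards [ae_eq_integral_of_initial hB rfl
      ((hY i₀).isDominated.integrable ⟨0, le_rfl, hT.le⟩)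
      (measurable_of_isProgressive (hY i₀).progressive _)] with ω hω
    rw [hsup, ← hω]
  · rw [H.profit_eq S hS]
    exact H.profit_le S'
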